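/- Let $N\ge 2$, let $\Omega\subset\mathbb{R}^N$ be a bounded Lipschitz domain (nonempty, open, connected, and locally near each boundary point the epigraph of a Lipschitz function in suitable orthonormal coordinates), and let $0<s<1<p<N/s$. For measurable $u:\mathbb{R}^N\to\mathbb{R}$ put $$[u]_{s,p}=\Big(\int_{\mathbb{R}^N}\int_{\mathbb{R}^N}\frac{|u(x)-u(y)|^p}{|x-y|^{N+sp}}\,dx\,dy\Big)^{1/p},$$ let $|\cdot|_r$ be the norm of $L^r(\Omega)$, and let $W_0^{s,p}(\Omega)$ be the closure of $C_0^\infty(\Omega)$ in the norm $[u]_{s,p}+|u|_p$, its elements being extended by $0$ to $\mathbb{R}^N$ and identified when equal almost everywhere. There is a unique $\phi\in W_0^{s,p}(\Omega)$, the $(s,p)$-torsion function $\phi=\phi_p^s$ of $\Omega$, such that $$\int_{\mathbb{R}^N}\int_{\mathbb{R}^N}\frac{|\phi(x)-\phi(y)|^{p-2}(\phi(x)-\phi(y))(v(x)-v(y))}{|x-y|^{N+sp}}\,dx\,dy=\int_\Omega v\,dx\qquad\text{for all } v\in W_0^{s,p}(\Omega).$$ It satisfies $\phi_p^s\ge 0$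 almost everywhere and $0<|\phi_p^s|_1<\infty$, and $$\frac{1}{|\phi_p^s|_1^{p-1}}=\min\Big\{[v]_{s,p}^p : v\in W_0^{s,p}(\Omega),\ |v|_1=1\Big\}=\Big[\frac{\phi_p^s}{|\phi_p^s|_1}\Big]_{s,p}^p .$$ Moreover, $\phi_p^s/|\phi_p^s|_1$ is the only nonnegative function in $W_0^{s,p}(\Omega)$ with $|v|_1=1$ at which this minimum is attained. -/

import Mathlib

open MeasureTheory Set
open scoped ENNReal NNReal ContDiff

noncomputable section

/-- A bounded Lipschitz domain of `ℝ^N`: a bounded, connected, nonempty open set which near each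
of its boundary points is, in the direction of some unit vector `ν`, the strict epigraph of a
Lipschitz function of the component orthogonal to `ν`. -/
structure IsBoundedLipschitzDomain {N : ℕ} (Ω : Set (EuclideanSpace ℝ (Fin N))) : Prop where
  isOpen : IsOpen Ω
  isConnected : IsConnected Ω
  isBounded : Bornology.IsBounded Ω
  lipschitz_boundary : ∀ x ∈ frontier Ω,
    ∃ (ν : EuclideanSpace ℝ (Fin N)) (g : EuclideanSpace ℝ (Fin N) → ℝ) (K : ℝ≥0) (r : ℝ),
      ‖ν‖ = 1 ∧ LipschitzWith K g ∧ 0 < r ∧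
        ∀ y ∈ Metric.ball x r, (y ∈ Ω ↔ g (y - inner ℝ ν y • ν) < inner ℝ ν y)

/-- The Gagliardo seminorm `[u]_{s,p}` on `ℝ^N`, with values in `[0, ∞]`. -/
def gagliardoSeminorm {N : ℕ} (s p : ℝ) (u : EuclideanSpace ℝ (Fin N) → ℝ) : ℝ≥0∞ :=
  (∫⁻ z : EuclideanSpace ℝ (Fin N) × EuclideanSpace ℝ (Fin N),
    ENNReal.ofReal (|u z.1 - u z.2| ^ p / ‖z.1 - z.2‖ ^ ((N : ℝ) + s * p))) ^ (1 / p)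

/-- The norm `|u|_r` of `L^r(Ω)`, with values in `[0, ∞]`. -/
def normL {N : ℕ} (r : ℝ) (Ω : Set (EuclideanSpace ℝ (Fin N)))
    (u : EuclideanSpace ℝ (Fin N) → ℝ) : ℝ≥0∞ :=
  eLpNorm u (ENNReal.ofReal r) (volume.restrict Ω)

/-- `C_0^∞(Ω)`: smooth functions with compact support contained in `Ω`. -/
def IsTestFunction {N : ℕ} (Ω : Set (EuclideanSpace ℝ (Fin N)))
    (η : EuclideanSpace ℝ (Fin N) → ℝ) : Prop :=
  ContDiff ℝ ∞ η ∧ HasCompactSupport η ∧ tsupport η ⊆ Ω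

/-- Membership in `W_0^{s,p}(Ω)`, the closure of `C_0^∞(Ω)` for the norm `[u]_{s,p} + |u|_p`.
Its elements are regarded as functions on `ℝ^N` which vanish (a.e.) outside `Ω`; functions that
agree almost everywhere represent the same element. -/
structure MemW0 {N : ℕ} (s p : ℝ) (Ω : Set (EuclideanSpace ℝ (Fin N)))
    (u : EuclideanSpace ℝ (Fin N) → ℝ) : Prop where
  aestronglyMeasurable : AEStronglyMeasurable u volume
  ae_eq_zero : ∀ᵐ x ∂volume, x ∉ Ω → u x = 0
  approx : ∀ ε : ℝ≥0∞, 0 < ε → ∃ η : EuclideanSpace ℝ (Fin N) → ℝ, IsTestFunction Ω η ∧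
    gagliardoSeminorm s p (fun x => u x - η x) + normL p Ω (fun x => u x - η x) < ε

/-- The pairing `⟨(-Δ)_p^s u, v⟩`. -/
def fracPLaplacePairing {N : ℕ} (s p : ℝ) (u v : EuclideanSpace ℝ (Fin N) → ℝ) : ℝ :=
  ∫ z : EuclideanSpace ℝ (Fin N) × EuclideanSpace ℝ (Fin N),
    |u z.1 - u z.2| ^ (p - 2) * (u z.1 - u z.2) * (v z.1 - v z.2) /
      ‖z.1 - z.2‖ ^ ((N : ℝ) + s * p)

/-- `u` is a weak solution of `(-Δ)_p^s u = f` in `Ω`, `u = 0` in `ℝ^N ∖ Ω`. -/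
def IsWeakSolution {N : ℕ} (s p : ℝ) (Ω : Set (EuclideanSpace ℝ (Fin N)))
    (f u : EuclideanSpace ℝ (Fin N) → ℝ) : Prop :=
  MemW0 s p Ω u ∧ ∀ v : EuclideanSpace ℝ (Fin N) → ℝ, MemW0 s p Ω v →
    fracPLaplacePairing s p u v = ∫ x in Ω, f x * v x

/-- `φ` is (a representative of) the `(s,p)`-torsion function of `Ω`. -/
def IsTorsionFunction {N : ℕ} (s p : ℝ) (Ω : Set (EuclideanSpace ℝ (Fin N)))
    (φ : EuclideanSpace ℝ (Fin N) → ℝ) : Prop :=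
  IsWeakSolution s p Ω (fun _ => 1) φ

/-- The normalization `φ / |φ|_1`. -/
def normalizeL1 {N : ℕ} (Ω : Set (EuclideanSpace ℝ (Fin N)))
    (φ : EuclideanSpace ℝ (Fin N) → ℝ) : EuclideanSpace ℝ (Fin N) → ℝ :=
  fun x => φ x / (normL 1 Ω φ).toReal

end

/-!
The difference quotient `(u x - u y) / |x - y| ^ (N / p + s)` embeds `W_0^{s,p}(Ω)` isometrically,
for the seminorm `[·]_{s,p}`, onto a closed subspace of `L^p(ℝ^N × ℝ^N)`; closedness and the
continuity of `v ↦ ∫_Ω v` both come from the Poincaré inequality on sets of finite measure. Since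
`L^p` is uniformly convex, the image of the affine hyperplane `∫_Ω v = 1` has a point of minimal
norm, and a multiple of it solves the torsion equation. For a solution `φ`, testing with `v` in the
tangent inequality `|b| ^ p ≥ |a| ^ p + p |a| ^ (p - 2) a (b - a)` gives
`p ∫_Ω v ≤ [v] ^ p + (p - 1) ∫_Ω φ`, with equality only for `v = φ`. Uniqueness follows, `v = |φ|`
yields the sign of `φ`, and multiples of functions with `|v|_1 = 1` yield the minimum and the
minimizer.
-/

/-! ### Convexity of `‖·‖ ^ p` -/

section NormRpow

variable {E : Type*} [NormedAddCommGroup E] [NormedSpace ℝ E] {p : ℝ}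

theorem norm_smul_rpow (c : ℝ) (x : E) : ‖c • x‖ ^ p = |c| ^ p * ‖x‖ ^ p := by
  rw [norm_smul, Real.norm_eq_abs, Real.mul_rpow (abs_nonneg c) (norm_nonneg x)]

theorem strictConvexOn_norm_rpow [StrictConvexSpace ℝ E] (hp : 1 < p) :
    StrictConvexOn ℝ univ fun x : E => ‖x‖ ^ p := by
  refine ⟨convex_univ, fun x _ y _ hxy a b ha hb hab => ?_⟩
  rcases eq_or_ne ‖x‖ ‖y‖ with h | h
  · calc ‖a • x + b • y‖ ^ p < ‖x‖ ^ p :=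
          Real.rpow_lt_rpow (norm_nonneg _)
            (norm_combo_lt_of_ne le_rfl h.symm.le hxy ha hb hab) (by linarith)
      _ = a • ‖x‖ ^ p + b • ‖y‖ ^ p := by rw [← h, ← add_smul, hab, one_smul]
  · calc ‖a • x + b • y‖ ^ p ≤ (a * ‖x‖ + b * ‖y‖) ^ p := by
          refine Real.rpow_le_rpow (norm_nonneg _) ?_ (by linarith)
          exact (norm_add_le _ _).trans_eq (by rw [norm_smul_of_nonneg ha.le,
            norm_smul_of_nonneg hb.le])
      _ < a • ‖x‖ ^ p + b • ‖y‖ ^ p :=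
          (strictConvexOn_rpow hp).2 (norm_nonneg x) (norm_nonneg y) h ha hb hab

theorem norm_add_rpow_lt [StrictConvexSpace ℝ E] (hp : 1 < p) {x y : E} (hxy : x ≠ y) :
    ‖x + y‖ ^ p < 2 ^ (p - 1) * (‖x‖ ^ p + ‖y‖ ^ p) := by
  have hmid : ‖(2⁻¹ : ℝ) • (x + y)‖ ^ p < 2⁻¹ * (‖x‖ ^ p + ‖y‖ ^ p) := by
    have := (strictConvexOn_norm_rpow hp).2 (mem_univ x) (mem_univ y) hxy
      (inv_pos.2 (two_pos (α := ℝ))) (inv_pos.2 two_pos) (by norm_num)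
    simpa only [smul_add, mul_add, smul_eq_mul] using this
  rw [norm_smul_rpow, abs_of_nonneg (by norm_num), Real.inv_rpow (by norm_num),
    inv_mul_lt_iff₀ (by positivity)] at hmid
  rwa [Real.rpow_sub_one two_ne_zero, div_eq_mul_inv, mul_assoc]

theorem norm_add_rpow_le [StrictConvexSpace ℝ E] (hp : 1 < p) (x y : E) :
    ‖x + y‖ ^ p ≤ 2 ^ (p - 1) * (‖x‖ ^ p + ‖y‖ ^ p) := by
  rcases eq_or_ne x y with rfl | hxy
  · rw [← two_smul ℝ x, norm_smul_rpow, abs_two, ← two_mul, ← mul_assoc,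
      ← Real.rpow_add_one two_ne_zero, sub_add_cancel]
  · exact (norm_add_rpow_lt hp hxy).le

theorem exists_norm_sub_rpow_le_of_norm_eq_one [StrictConvexSpace ℝ E] [FiniteDimensional ℝ E]
    (hp : 1 < p) {ε : ℝ} (hε : 0 < ε) : ∃ C : ℝ, 0 < C ∧ ∀ q : E × E, ‖q‖ = 1 →
      ‖q.1 - q.2‖ ^ p ≤ ε * (‖q.1‖ ^ p + ‖q.2‖ ^ p) +
        C * (2 ^ (p - 1) * (‖q.1‖ ^ p + ‖q.2‖ ^ p) - ‖q.1 + q.2‖ ^ p) := by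
  have hp0 : 0 ≤ p := by linarith
  have hcont {f : E × E → E} (hf : Continuous f) : Continuous fun q => ‖f q‖ ^ p :=
    hf.norm.rpow_const fun _ => Or.inr hp0
  have : ProperSpace (E × E) := FiniteDimensional.proper_real (E × E)
  have hcompact : IsCompact (Metric.sphere (0 : E × E) 1 ∩ {q | ε ≤ ‖q.1 - q.2‖ ^ p}) :=
    (isCompact_sphere 0 1).inter_right
      (isClosed_le continuous_const (hcont (continuous_fst.sub continuous_snd)))
  obtain ⟨m, hm0, hm⟩ := hcompact.exists_forall_le' (a := 0)
    (f := fun q : E × E => 2 ^ (p - 1) * (‖q.1‖ ^ p + ‖q.2‖ ^ p) - ‖q.1 + q.2‖ ^ p)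
    (((((hcont continuous_fst).add (hcont continuous_snd)).const_mul _).sub
      (hcont (continuous_fst.add continuous_snd))).continuousOn) fun q hq => by
      refine sub_pos.2 (norm_add_rpow_lt hp fun h => ?_)
      have := hq.2
      rw [mem_ofPred_eq, h, sub_self, norm_zero, Real.zero_rpow (by linarith)] at this
      linarith
  refine ⟨2 ^ p / m, by positivity, fun q hq => ?_⟩
  have hdefect := sub_nonneg.2 (norm_add_rpow_le hp q.1 q.2)
  have hone : 1 ≤ ‖q.1‖ ^ p + ‖q.2‖ ^ p := by
    rcases max_choice ‖q.1‖ ‖q.2‖ with h | h <;> rw [← Prod.norm_def, hq] at h <;>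
      rw [← h, Real.one_rpow] <;> simp only [le_add_iff_nonneg_left, le_add_iff_nonneg_right] <;>
      positivity
  rcases lt_or_ge (‖q.1 - q.2‖ ^ p) ε with hnear | hfar
  · have : 0 ≤ 2 ^ p / m * (2 ^ (p - 1) * (‖q.1‖ ^ p + ‖q.2‖ ^ p) - ‖q.1 + q.2‖ ^ p) := by
      positivity
    nlinarith
  · have htwo : ‖q.1 - q.2‖ ^ p ≤ 2 ^ p :=
      Real.rpow_le_rpow (norm_nonneg _) ((norm_sub_le _ _).trans (by
        linarith [norm_fst_le q, norm_snd_le q])) hp0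
    have hlower := mul_le_mul_of_nonneg_left (hm q ⟨mem_sphere_zero_iff_norm.2 hq, hfar⟩)
      (show 0 ≤ 2 ^ p / m by positivity)
    rw [div_mul_cancel₀ _ hm0.ne'] at hlower
    nlinarith

/-- The constants come from compactness of the unit sphere of `E × E`; both sides are homogeneous
of degree `p`. -/
theorem exists_norm_sub_rpow_le [StrictConvexSpace ℝ E] [FiniteDimensional ℝ E]
    (hp : 1 < p) {ε : ℝ} (hε : 0 < ε) : ∃ C : ℝ, 0 < C ∧ ∀ x y : E,
      ‖x - y‖ ^ p ≤ ε * (‖x‖ ^ p + ‖y‖ ^ p) +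
        C * (2 ^ (p - 1) * (‖x‖ ^ p + ‖y‖ ^ p) - ‖x + y‖ ^ p) := by
  obtain ⟨C, hC, hbound⟩ := exists_norm_sub_rpow_le_of_norm_eq_one (E := E) hp hε
  refine ⟨C, hC, fun x y => ?_⟩
  rcases eq_or_ne (x, y) 0 with h0 | h0
  · obtain ⟨rfl, rfl⟩ := Prod.mk_eq_zero.1 h0
    simp [Real.zero_rpow (by linarith : p ≠ 0)]
  · have hpos : 0 < ‖(x, y)‖⁻¹ ^ p := Real.rpow_pos_of_pos (inv_pos.2 (norm_pos_iff.2 h0)) p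
    have := hbound (‖(x, y)‖⁻¹ • (x, y)) (norm_smul_inv_norm h0)
    simp only [Prod.smul_fst, Prod.smul_snd, ← smul_sub, ← smul_add, norm_smul_rpow,
      abs_of_nonneg (inv_nonneg.2 (norm_nonneg (x, y)))] at this
    refine le_of_mul_le_mul_left ?_ hpos
    linarith

end NormRpow

/-! ### Uniform convexity of `L^p` -/

section UniformConvexity

variable {α E : Type*} [MeasurableSpace α] {μ : Measure α} [NormedAddCommGroup E] {p : ℝ}

theorem integrable_norm_rpow_of_memLp (hp : 0 < p) {f : α → E}
    (hf : MemLp f (ENNReal.ofReal p) μ) : Integrable (fun x => ‖f x‖ ^ p) μ := by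
  simpa only [ENNReal.toReal_ofReal hp.le] using
    hf.integrable_norm_rpow (ENNReal.ofReal_pos.2 hp).ne' ENNReal.ofReal_ne_top

theorem eLpNorm_ofReal_rpow (hp : 0 < p) {f : α → E} (hf : MemLp f (ENNReal.ofReal p) μ) :
    eLpNorm f (ENNReal.ofReal p) μ ^ p = ENNReal.ofReal (∫ x, ‖f x‖ ^ p ∂μ) := by
  rw [hf.eLpNorm_eq_integral_rpow_norm (ENNReal.ofReal_pos.2 hp).ne' ENNReal.ofReal_ne_top,
    ENNReal.toReal_ofReal hp.le, ENNReal.ofReal_rpow_of_nonneg (by positivity) hp.le,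
    Real.rpow_inv_rpow (by positivity) hp.ne']

theorem norm_Lp_rpow (hp : 0 < p) (f : Lp E (ENNReal.ofReal p) μ) :
    ‖f‖ ^ p = ∫ x, ‖f x‖ ^ p ∂μ := by
  rw [Lp.norm_def, ENNReal.toReal_rpow, eLpNorm_ofReal_rpow hp (Lp.memLp f),
    ENNReal.toReal_ofReal (by positivity)]

variable [NormedSpace ℝ E] [StrictConvexSpace ℝ E] [FiniteDimensional ℝ E]

theorem exists_norm_Lp_sub_rpow_le (hp : 1 < p) {ε : ℝ} (hε : 0 < ε) :
    ∃ C : ℝ, 0 < C ∧ ∀ f g : Lp E (ENNReal.ofReal p) μ,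
      ‖f - g‖ ^ p ≤ ε * (‖f‖ ^ p + ‖g‖ ^ p) +
        C * (2 ^ (p - 1) * (‖f‖ ^ p + ‖g‖ ^ p) - ‖f + g‖ ^ p) := by
  have hp0 : 0 < p := by linarith
  obtain ⟨C, hC, hbound⟩ := exists_norm_sub_rpow_le (E := E) hp hε
  refine ⟨C, hC, fun f g => ?_⟩
  have hint (h : Lp E (ENNReal.ofReal p) μ) : Integrable (fun x => ‖h x‖ ^ p) μ :=
    integrable_norm_rpow_of_memLp hp0 (Lp.memLp h)
  have hsum : Integrable (fun x => ‖f x‖ ^ p + ‖g x‖ ^ p) μ := (hint f).add (hint g)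
  have hdefect : Integrable
      (fun x => C * (2 ^ (p - 1) * (‖f x‖ ^ p + ‖g x‖ ^ p) - ‖(f + g) x‖ ^ p)) μ :=
    ((hsum.const_mul _).sub (hint _)).const_mul C
  simp only [norm_Lp_rpow hp0]
  rw [← integral_add (hint f) (hint g), ← integral_const_mul, ← integral_const_mul,
    ← integral_sub (hsum.const_mul _) (hint _), ← integral_const_mul,
    ← integral_add (hsum.const_mul ε) hdefect]
  refine integral_mono_ae (hint _) ((hsum.const_mul ε).add hdefect) ?_
  filter_upwards [Lp.coeFn_sub f g, Lp.coeFn_add f g] with x hsub hadd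
  simpa only [hsub, hadd, Pi.sub_apply, Pi.add_apply] using hbound (f x) (g x)

theorem uniformConvexSpace_Lp [Fact (1 ≤ ENNReal.ofReal p)] (hp : 1 < p) :
    UniformConvexSpace (Lp E (ENNReal.ofReal p) μ) where
  uniform_convex ε hε := by
    have hp0 : 0 < p := by linarith
    obtain ⟨C, hC, hbound⟩ := exists_norm_Lp_sub_rpow_le (E := E) (μ := μ) hp
      (show 0 < ε ^ p / 4 by positivity)
    set c := max (2 ^ p - ε ^ p / (2 * C)) 0
    have hclt : c ^ p⁻¹ < 2 := by
      have : c < 2 ^ p := max_lt (sub_lt_self _ (by positivity)) (by positivity)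
      rwa [Real.rpow_inv_lt_iff_of_pos (le_max_right _ _) zero_le_two hp0]
    refine ⟨2 - c ^ p⁻¹, by linarith, fun f hf g hg hfg => ?_⟩
    have hdefect := hbound f g
    rw [hf, hg, Real.one_rpow, one_add_one_eq_two, ← Real.rpow_add_one two_ne_zero,
      sub_add_cancel] at hdefect
    have hfar : ε ^ p ≤ ‖f - g‖ ^ p := Real.rpow_le_rpow hε.le hfg hp0.le
    have hle : ‖f + g‖ ^ p ≤ c := by
      refine le_max_of_le_left ?_
      rw [le_sub_comm, div_le_iff₀ (by positivity)]
      linarith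
    rw [sub_sub_cancel]
    exact (Real.le_rpow_inv_iff_of_pos (norm_nonneg _) (le_max_right _ _) hp0).2 hle

end UniformConvexity

section Domination

open Filter Topology

variable {α : Type*} [MeasurableSpace α] {μ : Measure α} {q : ℝ≥0∞}

/-- The dominated convergence theorem in `L^q`, with a dominating sequence that converges in `L^q`
in place of a fixed bound. -/
theorem tendsto_eLpNorm_sub_of_norm_le {E F : Type*} [NormedAddCommGroup E] [NormedAddCommGroup F]
    (hq : 1 ≤ q) (hqtop : q ≠ ⊤) {G : ℕ → α → F} {G₀ : α → F} (hG : ∀ n, MemLp (G n) q μ)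
    (hG₀ : MemLp G₀ q μ) (hlim : Tendsto (fun n => eLpNorm (G n - G₀) q μ) atTop (𝓝 0))
    {f : ℕ → α → E} {f₀ : α → E} (hf : ∀ n, AEStronglyMeasurable (f n) μ) (hf₀ : MemLp f₀ q μ)
    (hle : ∀ n x, ‖f n x‖ ≤ ‖G n x‖)
    (hae : ∀ᵐ x ∂μ, Tendsto (fun n => f n x) atTop (𝓝 (f₀ x))) :
    Tendsto (fun n => eLpNorm (f n - f₀) q μ) atTop (𝓝 0) := by
  obtain ⟨-, hunif, htight⟩ := (tendstoInMeasure_iff_tendsto_Lp hq hqtop hG hG₀).2 hlim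
  have hindicator (n : ℕ) (t : Set α) :
      eLpNorm (t.indicator (f n)) q μ ≤ eLpNorm (t.indicator (G n)) q μ :=
    eLpNorm_mono fun x => by
      simp only [norm_indicator_eq_indicator_norm]
      exact indicator_le_indicator (hle n x)
  refine tendsto_Lp_of_tendsto_ae hq hqtop hf hf₀ (fun ε hε => ?_) (fun ε hε => ?_) hae
  · obtain ⟨δ, hδ, h⟩ := hunif hε
    exact ⟨δ, hδ, fun n t ht hμt => (hindicator n t).trans (h n t ht hμt)⟩
  · obtain ⟨t, ht, h⟩ := htight hε
    exact ⟨t, ht, fun n => (hindicator n _).trans (h n)⟩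

end Domination

section MinimalNorm

open Filter Topology

variable {E : Type*} [NormedAddCommGroup E] [NormedSpace ℝ E] [UniformConvexSpace E]

theorem tendsto_norm_sub_of_le_norm_add {ι : Type*} {l : Filter ι} {x y : ι → E} {r : ℝ}
    (hx : Tendsto (fun i => ‖x i‖) l (𝓝 r)) (hy : Tendsto (fun i => ‖y i‖) l (𝓝 r))
    (hxy : ∀ i, 2 * r ≤ ‖x i + y i‖) : Tendsto (fun i => ‖x i - y i‖) l (𝓝 0) := by
  refine tendsto_order.2 ⟨fun a ha => .of_forall fun i => ha.trans_le (norm_nonneg _),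
    fun ε hε => ?_⟩
  rcases le_or_gt r 0 with hr | hr
  · filter_upwards [hx.eventually_lt_const (hr.trans_lt (half_pos hε)),
      hy.eventually_lt_const (hr.trans_lt (half_pos hε))] with i hxi hyi
    exact (norm_sub_le _ _).trans_lt (by linarith)
  obtain ⟨δ, hδ, hconvex⟩ :=
    exists_forall_closed_ball_dist_add_le_two_sub E (show 0 < ε / (2 * r) by positivity)
  have hmin : 0 < min (δ / 2) (1 / 2) := by positivity
  set R := r * (1 + min (δ / 2) (1 / 2)) with hR
  have hrR : r < R := lt_mul_of_one_lt_right hr (by linarith)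
  have hR0 : 0 < R := hr.trans hrR
  have hR2 : R ≤ 2 * r := by nlinarith [min_le_right (δ / 2) (1 / 2)]
  have hδR : (2 - δ) * R < 2 * r := by
    have : (2 - δ) * (1 + min (δ / 2) (1 / 2)) < 2 := by
      nlinarith [min_le_left (δ / 2) (1 / 2), mul_pos hδ hmin]
    rw [hR]
    nlinarith
  filter_upwards [hx.eventually_le_const hrR, hy.eventually_le_const hrR] with i hxi hyi
  by_contra! hfar
  have hball {z : E} (hz : ‖z‖ ≤ R) : ‖R⁻¹ • z‖ ≤ 1 := by
    rw [norm_smul_of_nonneg (by positivity)]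
    exact inv_mul_le_one_of_le₀ hz hR0.le
  have hle := hconvex (hball hxi) (hball hyi) (by
    rw [← smul_sub, norm_smul_of_nonneg (by positivity), ← div_eq_inv_mul]
    exact div_le_div₀ (norm_nonneg _) hfar hR0 hR2)
  rw [← smul_add, norm_smul_of_nonneg (by positivity), inv_mul_le_iff₀ hR0] at hle
  linarith [hxy i]

theorem exists_norm_le_of_isClosed_of_convex [CompleteSpace E] {K : Set E} (hne : K.Nonempty)
    (hclosed : IsClosed K) (hconvex : Convex ℝ K) : ∃ x ∈ K, ∀ y ∈ K, ‖x‖ ≤ ‖y‖ := by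
  have hbdd : BddBelow (norm '' K) := ⟨0, forall_mem_image.2 fun x _ => norm_nonneg x⟩
  have hinf {x : E} (hx : x ∈ K) : sInf (norm '' K) ≤ ‖x‖ := csInf_le hbdd (mem_image_of_mem _ hx)
  obtain ⟨t, -, ht, htK⟩ := exists_seq_tendsto_sInf (hne.image norm) hbdd
  choose x hxK hxt using htK
  rw [← funext hxt] at ht
  have hmid (m n : ℕ) : 2 * sInf (norm '' K) ≤ ‖x m + x n‖ := by
    have := hinf (hconvex (hxK m) (hxK n) (inv_nonneg.2 zero_le_two) (inv_nonneg.2 zero_le_two)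
      (by norm_num : (2⁻¹ : ℝ) + 2⁻¹ = 1))
    rw [← smul_add, norm_smul_of_nonneg (by norm_num)] at this
    linarith
  have hcauchy : CauchySeq x := by
    simp only [cauchySeq_iff_tendsto_dist_atTop_0, dist_eq_norm]
    rw [← prod_atTop_atTop_eq]
    exact tendsto_norm_sub_of_le_norm_add (ht.comp tendsto_fst)
      (ht.comp tendsto_snd) fun n => hmid n.1 n.2
  obtain ⟨z, hz⟩ := cauchySeq_tendsto_of_complete hcauchy
  have hnorm : ‖z‖ = sInf (norm '' K) := tendsto_nhds_unique hz.norm ht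
  exact ⟨z, hclosed.mem_of_tendsto hz (.of_forall hxK), fun y hy => hnorm ▸ hinf hy⟩

end MinimalNorm

/-! ### The duality pairing of `L^p` -/

section AbsRpow

variable {p : ℝ}

theorem abs_rpow_tangent_lt (hp : 1 < p) {a b : ℝ} (hab : a ≠ b) :
    |a| ^ p + p * (|a| ^ (p - 2) * a * (b - a)) < |b| ^ p := by
  have hderiv := hasDerivAt_abs_rpow a hp
  have hconvex := strictConvexOn_norm_rpow (E := ℝ) hp
  simp only [Real.norm_eq_abs] at hconvex
  rcases lt_or_gt_of_ne hab with h | h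
  · have := hconvex.lt_slope_of_hasDerivAt (mem_univ a) (mem_univ b) h hderiv
    rw [slope_def_field, lt_div_iff₀ (by linarith)] at this
    linarith
  · have := hconvex.slope_lt_of_hasDerivAt (mem_univ b) (mem_univ a) h hderiv
    rw [slope_def_field, div_lt_iff₀ (by linarith)] at this
    linarith

theorem abs_rpow_tangent_le (hp : 1 < p) (a b : ℝ) :
    |a| ^ p + p * (|a| ^ (p - 2) * a * (b - a)) ≤ |b| ^ p := by
  rcases eq_or_ne a b with rfl | h
  · rw [sub_self, mul_zero, mul_zero, add_zero]
  · exact (abs_rpow_tangent_lt hp h).le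

theorem abs_rpow_sub_two_mul_self_mul_self (hp : p ≠ 0) (a : ℝ) :
    |a| ^ (p - 2) * a * a = |a| ^ p := by
  rcases eq_or_ne a 0 with rfl | h
  · rw [mul_zero, abs_zero, Real.zero_rpow hp]
  · rw [mul_assoc, ← pow_two, ← sq_abs, ← Real.rpow_two, ← Real.rpow_add (abs_pos.2 h),
      sub_add_cancel]

theorem abs_abs_rpow_sub_two_mul_self_mul_le (hp : 1 < p) {a b c : ℝ} (ha : |a| ≤ c)
    (hb : |b| ≤ c) : |(|a| ^ (p - 2) * a * b)| ≤ c ^ p := by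
  have hc : 0 ≤ c := (abs_nonneg a).trans ha
  rcases eq_or_ne a 0 with rfl | h
  · rw [mul_zero, zero_mul, abs_zero]
    positivity
  · calc |(|a| ^ (p - 2) * a * b)| = |a| ^ (p - 1) * |b| := by
          rw [abs_mul, abs_mul, abs_of_nonneg (by positivity),
            ← Real.rpow_add_one (abs_pos.2 h).ne']
          ring_nf
      _ ≤ c ^ (p - 1) * c := by gcongr
      _ = c ^ p := by
          rw [← Real.rpow_add_one ((abs_pos.2 h).trans_le ha).ne', sub_add_cancel]

end AbsRpow

section DualityPairing

variable {α : Type*} [MeasurableSpace α] {μ : Measure α} {p : ℝ} {f g : α → ℝ}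

/-- The pairing of `g` with the derivative `|f| ^ (p - 2) f` of `|f| ^ p / p`, that is, with the
image of `f` under the duality map of `L^p`. -/
noncomputable def dualityPairing (p : ℝ) (μ : Measure α) (f g : α → ℝ) : ℝ :=
  ∫ x, |f x| ^ (p - 2) * f x * g x ∂μ

theorem dualityPairing_congr_ae {f' g' : α → ℝ} (hf : f =ᵐ[μ] f') (hg : g =ᵐ[μ] g') :
    dualityPairing p μ f g = dualityPairing p μ f' g' := by
  refine integral_congr_ae ?_
  filter_upwards [hf, hg] with x hfx hgx
  rw [hfx, hgx]

theorem dualityPairing_self (hp : p ≠ 0) (f : α → ℝ) :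
    dualityPairing p μ f f = ∫ x, |f x| ^ p ∂μ :=
  integral_congr_ae (.of_forall fun x => abs_rpow_sub_two_mul_self_mul_self hp (f x))

theorem dualityPairing_zero_left (g : α → ℝ) : dualityPairing p μ 0 g = 0 := by
  simp [dualityPairing]

theorem dualityPairing_smul_left {c : ℝ} (hc : 0 < c) (f g : α → ℝ) :
    dualityPairing p μ (c • f) g = c ^ (p - 1) * dualityPairing p μ f g := by
  rw [dualityPairing, dualityPairing, ← integral_const_mul]
  refine integral_congr_ae (.of_forall fun x => ?_)
  simp only [Pi.smul_apply, smul_eq_mul, abs_mul, abs_of_pos hc]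
  rw [Real.mul_rpow hc.le (abs_nonneg _), show p - 1 = p - 2 + 1 by ring, Real.rpow_add_one hc.ne']
  ring

theorem dualityPairing_smul_right (c : ℝ) (f g : α → ℝ) :
    dualityPairing p μ f (c • g) = c * dualityPairing p μ f g := by
  rw [dualityPairing, dualityPairing, ← integral_const_mul]
  refine integral_congr_ae (.of_forall fun x => ?_)
  simp only [Pi.smul_apply, smul_eq_mul]
  ring

theorem aestronglyMeasurable_abs_rpow_mul (q : ℝ) (hf : AEStronglyMeasurable f μ)
    (hg : AEStronglyMeasurable g μ) :
    AEStronglyMeasurable (fun x => |f x| ^ q * f x * g x) μ := by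
  have := hf.aemeasurable
  have := hg.aemeasurable
  exact AEMeasurable.aestronglyMeasurable (by fun_prop)

theorem integrable_abs_add_abs_rpow (hp : 0 < p) (hf : MemLp f (ENNReal.ofReal p) μ)
    (hg : MemLp g (ENNReal.ofReal p) μ) : Integrable (fun x => (|f x| + |g x|) ^ p) μ := by
  refine (integrable_norm_rpow_of_memLp hp (hf.abs.add hg.abs)).congr (.of_forall fun x => ?_)
  simp only [Pi.add_apply, Pi.abs_apply]
  rw [Real.norm_of_nonneg (by positivity)]

theorem integrable_dualityPairing (hp : 1 < p) (hf : MemLp f (ENNReal.ofReal p) μ)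
    (hg : MemLp g (ENNReal.ofReal p) μ) :
    Integrable (fun x => |f x| ^ (p - 2) * f x * g x) μ :=
  (integrable_abs_add_abs_rpow (by linarith) hf hg).mono'
    (aestronglyMeasurable_abs_rpow_mul _ hf.1 hg.1) (.of_forall fun _ =>
      abs_abs_rpow_sub_two_mul_self_mul_le hp (le_add_of_nonneg_right (abs_nonneg _))
        (le_add_of_nonneg_left (abs_nonneg _)))

theorem dualityPairing_add_right (hp : 1 < p) {h : α → ℝ} (hf : MemLp f (ENNReal.ofReal p) μ)
    (hg : MemLp g (ENNReal.ofReal p) μ) (hh : MemLp h (ENNReal.ofReal p) μ) :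
    dualityPairing p μ f (g + h) = dualityPairing p μ f g + dualityPairing p μ f h := by
  rw [dualityPairing, dualityPairing, dualityPairing,
    ← integral_add (integrable_dualityPairing hp hf hg) (integrable_dualityPairing hp hf hh)]
  exact integral_congr_ae (.of_forall fun x => mul_add _ _ _)

theorem hasDerivAt_integral_abs_add_mul_rpow (hp : 1 < p) (hf : MemLp f (ENNReal.ofReal p) μ)
    (hg : MemLp g (ENNReal.ofReal p) μ) :
    HasDerivAt (fun t : ℝ => ∫ x, |f x + t * g x| ^ p ∂μ) (p * dualityPairing p μ f g) 0 := by
  have hp0 : 0 < p := by linarith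
  have hline (t : ℝ) : MemLp (fun x => f x + t * g x) (ENNReal.ofReal p) μ :=
    hf.add (hg.const_mul t)
  have hbound : ∀ᵐ x ∂μ, ∀ t ∈ Metric.ball (0 : ℝ) 1,
      ‖p * (|f x + t * g x| ^ (p - 2) * (f x + t * g x) * g x)‖ ≤ p * (|f x| + |g x|) ^ p := by
    refine .of_forall fun x t ht => ?_
    have htg : |t * g x| ≤ |g x| := by
      rw [abs_mul]
      exact mul_le_of_le_one_left (abs_nonneg _) (by simpa using (mem_ball_zero_iff.1 ht).le)
    rw [Real.norm_eq_abs, abs_mul, abs_of_pos hp0]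
    gcongr
    exact abs_abs_rpow_sub_two_mul_self_mul_le hp ((abs_add_le _ _).trans (by gcongr))
      (le_add_of_nonneg_left (abs_nonneg _))
  have hderiv : ∀ᵐ x ∂μ, ∀ t ∈ Metric.ball (0 : ℝ) 1, HasDerivAt (fun t => |f x + t * g x| ^ p)
      (p * (|f x + t * g x| ^ (p - 2) * (f x + t * g x) * g x)) t := by
    refine .of_forall fun x t _ => ?_
    have hinner : HasDerivAt (fun t : ℝ => f x + t * g x) (g x) t := by
      simpa using ((hasDerivAt_id t).mul_const (g x)).const_add (f x)
    refine ((hasDerivAt_abs_rpow (f x + t * g x) hp).comp t hinner).congr_deriv ?_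
    rw [mul_assoc, mul_assoc, mul_assoc]
  have := (hasDerivAt_integral_of_dominated_loc_of_deriv_le (Metric.ball_mem_nhds 0 one_pos)
    (.of_forall fun t => (integrable_norm_rpow_of_memLp hp0 (hline t)).1)
    (integrable_norm_rpow_of_memLp hp0 (hline 0))
    ((aestronglyMeasurable_abs_rpow_mul _ (hline 0).1 hg.1).const_mul p) hbound
    ((integrable_abs_add_abs_rpow hp0 hf hg).const_mul p) hderiv).2
  simpa only [zero_mul, add_zero, integral_const_mul, Real.norm_eq_abs, dualityPairing] using this

end DualityPairing

section LpDualityPairing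

variable {α : Type*} [MeasurableSpace α] {μ : Measure α} {p : ℝ}

theorem dualityPairing_Lp_self (hp : 0 < p) (f : Lp ℝ (ENNReal.ofReal p) μ) :
    dualityPairing p μ f f = ‖f‖ ^ p := by
  rw [dualityPairing_self hp.ne', norm_Lp_rpow hp]
  simp only [Real.norm_eq_abs]

theorem hasDerivAt_norm_Lp_add_smul_rpow (hp : 1 < p) (f g : Lp ℝ (ENNReal.ofReal p) μ) :
    HasDerivAt (fun t : ℝ => ‖f + t • g‖ ^ p) (p * dualityPairing p μ f g) 0 := by
  refine (hasDerivAt_integral_abs_add_mul_rpow hp (Lp.memLp f) (Lp.memLp g)).congr_of_eventuallyEq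
    (.of_forall fun t => ?_)
  change ‖f + t • g‖ ^ p = _
  rw [norm_Lp_rpow (by linarith)]
  refine integral_congr_ae ?_
  filter_upwards [Lp.coeFn_add f (t • g), Lp.coeFn_smul t g] with x hadd hsmul
  rw [hadd, Pi.add_apply, hsmul, Pi.smul_apply, smul_eq_mul, Real.norm_eq_abs]

theorem integral_tangent_Lp (hp : 1 < p) (f g : Lp ℝ (ENNReal.ofReal p) μ) :
    Integrable (fun x => |g x| ^ p - (|f x| ^ p + p * (|f x| ^ (p - 2) * f x * (g x - f x)))) μ ∧
      ∫ x, |g x| ^ p - (|f x| ^ p + p * (|f x| ^ (p - 2) * f x * (g x - f x))) ∂μ =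
        ‖g‖ ^ p + (p - 1) * ‖f‖ ^ p - p * dualityPairing p μ f g := by
  have hp0 : 0 < p := by linarith
  have hint (h : Lp ℝ (ENNReal.ofReal p) μ) := integrable_norm_rpow_of_memLp hp0 (Lp.memLp h)
  have hpairing := integrable_dualityPairing hp (Lp.memLp f) (Lp.memLp g)
  have heq (x : α) : |g x| ^ p - (|f x| ^ p + p * (|f x| ^ (p - 2) * f x * (g x - f x))) =
      ‖g x‖ ^ p + (p - 1) * ‖f x‖ ^ p - p * (|f x| ^ (p - 2) * f x * g x) := by
    rw [mul_sub, abs_rpow_sub_two_mul_self_mul_self hp0.ne', Real.norm_eq_abs, Real.norm_eq_abs]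
    ring
  simp only [heq]
  have hsum : Integrable (fun x => ‖g x‖ ^ p + (p - 1) * ‖f x‖ ^ p) μ :=
    (hint g).add ((hint f).const_mul _)
  refine ⟨hsum.sub (hpairing.const_mul p), ?_⟩
  rw [integral_sub hsum (hpairing.const_mul p), integral_add (hint g) ((hint f).const_mul _),
    integral_const_mul, integral_const_mul, norm_Lp_rpow hp0, norm_Lp_rpow hp0, dualityPairing]

theorem mul_dualityPairing_le (hp : 1 < p) (f g : Lp ℝ (ENNReal.ofReal p) μ) :
    p * dualityPairing p μ f g ≤ ‖g‖ ^ p + (p - 1) * ‖f‖ ^ p := by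
  rw [← sub_nonneg, ← (integral_tangent_Lp hp f g).2]
  exact integral_nonneg fun x => sub_nonneg.2 (abs_rpow_tangent_le hp _ _)

theorem eq_of_mul_dualityPairing_eq (hp : 1 < p) {f g : Lp ℝ (ENNReal.ofReal p) μ}
    (h : p * dualityPairing p μ f g = ‖g‖ ^ p + (p - 1) * ‖f‖ ^ p) : g = f := by
  obtain ⟨hint, heq⟩ := integral_tangent_Lp hp f g
  rw [h, sub_self, integral_eq_zero_iff_of_nonneg
    (fun x => sub_nonneg.2 (abs_rpow_tangent_le hp _ _)) hint] at heq
  refine Lp.ext ?_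
  filter_upwards [heq] with x hx
  by_contra hne
  exact (abs_rpow_tangent_lt hp (Ne.symm hne)).ne' (sub_eq_zero.1 hx)

end LpDualityPairing

/-! ### Representation of functionals by the duality pairing -/

section DualityRepresentation

variable {α X : Type*} [MeasurableSpace α] {μ : Measure α} {p : ℝ} [AddCommGroup X] [Module ℝ X]
  {T : X →ₗ[ℝ] Lp ℝ (ENNReal.ofReal p) μ} {L : X →ₗ[ℝ] ℝ} {u v : X}

theorem norm_rpow_eq_of_dualityPairing_eq (hp : 0 < p)
    (hu : ∀ w, dualityPairing p μ (T u) (T w) = L w) : ‖T u‖ ^ p = L u := by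
  rw [← hu, dualityPairing_Lp_self hp]

theorem mul_apply_le_of_dualityPairing_eq (hp : 1 < p)
    (hu : ∀ w, dualityPairing p μ (T u) (T w) = L w) (v : X) :
    p * L v ≤ ‖T v‖ ^ p + (p - 1) * L u := by
  rw [← norm_rpow_eq_of_dualityPairing_eq (by linarith) hu, ← hu v]
  exact mul_dualityPairing_le hp (T u) (T v)

theorem eq_of_mul_apply_eq (hp : 1 < p) (hu : ∀ w, dualityPairing p μ (T u) (T w) = L w)
    (hv : p * L v = ‖T v‖ ^ p + (p - 1) * L u) : T v = T u := by
  rw [← norm_rpow_eq_of_dualityPairing_eq (by linarith) hu, ← hu v] at hv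
  exact eq_of_mul_dualityPairing_eq hp hv

theorem eq_of_dualityPairing_eq (hp : 1 < p) (hu : ∀ w, dualityPairing p μ (T u) (T w) = L w)
    (hv : ∀ w, dualityPairing p μ (T v) (T w) = L w) : T v = T u := by
  have huv := mul_apply_le_of_dualityPairing_eq hp hu v
  have hvu := mul_apply_le_of_dualityPairing_eq hp hv u
  have hnormu := norm_rpow_eq_of_dualityPairing_eq (by linarith) hu
  have hnormv := norm_rpow_eq_of_dualityPairing_eq (by linarith) hv
  have hL : L v = L u := by nlinarith
  exact eq_of_mul_apply_eq hp hu (by rw [hnormv, hL]; ring)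

variable [Fact (1 ≤ ENNReal.ofReal p)] {C : ℝ}

theorem eq_of_apply_le_of_norm_le (hp : 1 < p) (hu : ∀ w, dualityPairing p μ (T u) (T w) = L w)
    (hL : L u ≤ L v) (hT : ‖T v‖ ≤ ‖T u‖) : T v = T u := by
  have hpow : ‖T v‖ ^ p ≤ L u := norm_rpow_eq_of_dualityPairing_eq (by linarith) hu ▸
    Real.rpow_le_rpow (norm_nonneg _) hT (by linarith)
  have := mul_apply_le_of_dualityPairing_eq hp hu v
  exact eq_of_mul_apply_eq hp hu (by nlinarith)

theorem apply_pos_of_dualityPairing_eq (hp : 0 < p)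
    (hu : ∀ w, dualityPairing p μ (T u) (T w) = L w) (hL : L ≠ 0) : 0 < L u := by
  rw [← norm_rpow_eq_of_dualityPairing_eq hp hu]
  refine Real.rpow_pos_of_pos ((norm_nonneg _).lt_of_ne fun h => hL (LinearMap.ext fun w => ?_)) p
  have hzero := (Lp.norm_eq_zero_iff (ENNReal.ofReal_pos.2 hp)).1 h.symm
  rw [← hu, hzero, dualityPairing_congr_ae (Lp.coeFn_zero ..) .rfl, dualityPairing_zero_left,
    LinearMap.zero_apply]

theorem norm_smul_rpow_eq_mul (hA : 0 < L u) (v : X) :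
    ‖T (L u • v)‖ ^ p = L u * (L u ^ (p - 1) * ‖T v‖ ^ p) := by
  rw [map_smul, norm_smul_rpow, abs_of_pos hA, ← mul_assoc, mul_comm (L u),
    ← Real.rpow_add_one hA.ne', sub_add_cancel]

theorem one_div_le_norm_rpow (hp : 1 < p) (hu : ∀ w, dualityPairing p μ (T u) (T w) = L w)
    (hA : 0 < L u) (hv : L v = 1) : 1 / L u ^ (p - 1) ≤ ‖T v‖ ^ p := by
  have := mul_apply_le_of_dualityPairing_eq hp hu (L u • v)
  rw [norm_smul_rpow_eq_mul hA, map_smul, hv, smul_eq_mul, mul_one] at this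
  rw [div_le_iff₀' (by positivity)]
  exact le_of_mul_le_mul_left (by linarith) hA

theorem smul_eq_of_norm_rpow_eq_one_div (hp : 1 < p)
    (hu : ∀ w, dualityPairing p μ (T u) (T w) = L w) (hA : 0 < L u) (hv : L v = 1)
    (hmin : ‖T v‖ ^ p = 1 / L u ^ (p - 1)) : T (L u • v) = T u := by
  refine eq_of_mul_apply_eq hp hu ?_
  rw [norm_smul_rpow_eq_mul hA, hmin, mul_one_div_cancel (by positivity), map_smul, hv,
    smul_eq_mul]
  ring

theorem norm_inv_smul_rpow_eq_one_div (hp : 0 < p)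
    (hu : ∀ w, dualityPairing p μ (T u) (T w) = L w) (hA : 0 < L u) :
    ‖T ((L u)⁻¹ • u)‖ ^ p = 1 / L u ^ (p - 1) := by
  rw [map_smul, norm_smul_rpow, norm_rpow_eq_of_dualityPairing_eq hp hu, abs_of_pos (by positivity),
    Real.inv_rpow hA.le, Real.rpow_sub_one hA.ne', one_div_div, inv_mul_eq_div]

theorem isClosed_image_level_set (hT : IsClosed (range T)) (hL : ∀ w, |L w| ≤ C * ‖T w‖)
    (c : ℝ) : IsClosed (T '' {w | L w = c}) := by
  refine IsSeqClosed.isClosed fun y z hy hz => ?_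
  choose w hw hwy using hy
  obtain ⟨x, rfl⟩ := hT.mem_of_tendsto hz (.of_forall fun n => ⟨w n, hwy n⟩)
  refine ⟨x, ?_, rfl⟩
  have hlim : Filter.Tendsto (fun n => C * ‖T (w n - x)‖) Filter.atTop (nhds 0) := by
    simpa only [map_sub, hwy, mul_zero] using
      (tendsto_iff_norm_sub_tendsto_zero.1 hz).const_mul C
  have hconst : |c - L x| ≤ 0 := ge_of_tendsto' hlim fun n => by
    rw [← (hw n : L (w n) = c), ← map_sub]
    exact hL _
  exact (sub_eq_zero.1 (abs_nonpos_iff.1 hconst)).symm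

theorem exists_minimal_norm_of_apply_eq_one (hp : 1 < p) (hT : IsClosed (range T))
    (hL : ∀ w, |L w| ≤ C * ‖T w‖) (hL0 : L ≠ 0) :
    ∃ u, L u = 1 ∧ ∀ v, L v = 1 → ‖T u‖ ≤ ‖T v‖ := by
  obtain ⟨w, hw⟩ : ∃ w, L w = 1 := LinearMap.surjective hL0 1
  have := uniformConvexSpace_Lp (μ := μ) (E := ℝ) hp
  obtain ⟨_, ⟨u, hu, rfl⟩, hmin⟩ := exists_norm_le_of_isClosed_of_convex
    (Nonempty.image T (s := {w | L w = 1}) ⟨w, hw⟩)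
    (isClosed_image_level_set hT hL 1)
    ((convex_hyperplane L.isLinear 1).linear_image T)
  exact ⟨u, hu, fun v hv => hmin _ (mem_image_of_mem T hv)⟩

theorem dualityPairing_eq_zero_of_minimal_norm (hp : 1 < p)
    (hmin : ∀ w, L w = L u → ‖T u‖ ≤ ‖T w‖) (hv : L v = 0) :
    dualityPairing p μ (T u) (T v) = 0 := by
  have hlocal : IsLocalMin (fun t : ℝ => ‖T u + t • T v‖ ^ p) 0 := .of_forall fun t => by
    simp only [zero_smul, add_zero]
    refine Real.rpow_le_rpow (norm_nonneg _) ?_ (by linarith)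
    rw [← map_smul, ← map_add]
    exact hmin _ (by rw [map_add, map_smul, hv, smul_zero, add_zero])
  have hderiv := hlocal.hasDerivAt_eq_zero (hasDerivAt_norm_Lp_add_smul_rpow hp (T u) (T v))
  exact (mul_eq_zero.1 hderiv).resolve_left (by linarith)

theorem dualityPairing_eq_of_minimal_norm (hp : 1 < p) (hu : L u = 1)
    (hmin : ∀ w, L w = 1 → ‖T u‖ ≤ ‖T w‖) (v : X) :
    dualityPairing p μ (T u) (T v) = L v * ‖T u‖ ^ p := by
  have hker : dualityPairing p μ (T u) (T (v - L v • u)) = 0 :=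
    dualityPairing_eq_zero_of_minimal_norm hp (hu.symm ▸ hmin)
      (by rw [map_sub, map_smul, hu, smul_eq_mul, mul_one, sub_self])
  have hsplit : T v =ᵐ[μ] ⇑(T (v - L v • u)) + L v • ⇑(T u) := by
    have : T v = T (v - L v • u) + L v • T u := by rw [map_sub, map_smul, sub_add_cancel]
    rw [this]
    filter_upwards [Lp.coeFn_add (T (v - L v • u)) (L v • T u), Lp.coeFn_smul (L v) (T u)]
      with x hadd hsmul
    rw [hadd, Pi.add_apply, hsmul, Pi.add_apply]
  rw [dualityPairing_congr_ae .rfl hsplit, dualityPairing_add_right hp (Lp.memLp _) (Lp.memLp _)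
    ((Lp.memLp _).const_smul _), hker, zero_add, dualityPairing_smul_right,
    dualityPairing_Lp_self (by linarith)]

/-- The minimizer of the norm on `{L = 1}` satisfies the equation up to a Lagrange multiplier,
which is scaled away. -/
theorem exists_dualityPairing_eq (hp : 1 < p) (hT : IsClosed (range T))
    (hL : ∀ w, |L w| ≤ C * ‖T w‖) : ∃ u, ∀ v, dualityPairing p μ (T u) (T v) = L v := by
  rcases eq_or_ne L 0 with rfl | hL0
  · refine ⟨0, fun v => ?_⟩
    rw [map_zero, dualityPairing_congr_ae (Lp.coeFn_zero ..) .rfl, dualityPairing_zero_left,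
      LinearMap.zero_apply]
  obtain ⟨u, hu, hmin⟩ := exists_minimal_norm_of_apply_eq_one hp hT hL hL0
  have hpos : 0 < ‖T u‖ ^ p := by
    refine Real.rpow_pos_of_pos ((norm_nonneg _).lt_of_ne fun h => ?_) p
    have := hL u
    rw [hu, ← h, mul_zero, abs_one] at this
    linarith
  refine ⟨(‖T u‖ ^ p) ^ (-(p - 1)⁻¹) • u, fun v => ?_⟩
  rw [map_smul, dualityPairing_congr_ae (Lp.coeFn_smul ..) .rfl,
    dualityPairing_smul_left (by positivity), dualityPairing_eq_of_minimal_norm hp hu hmin,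
    ← Real.rpow_mul hpos.le, neg_mul, inv_mul_cancel₀ (by linarith), Real.rpow_neg_one,
    mul_comm (L v), inv_mul_cancel_left₀ hpos.ne']

end DualityRepresentation

/-! ### Difference quotients -/

section DifferenceQuotient

open Filter Topology

variable {E : Type*} [NormedAddCommGroup E] {σ p : ℝ}

/-- The difference quotient of order `σ` of a function, as a function of pairs of points. The
`L^p` norm of the difference quotient of order `d / p + s` is the Gagliardo seminorm of order `s`
in dimension `d`. On the diagonal it has the junk value `0`. -/
noncomputable def diffQuotient (σ : ℝ) : (E → ℝ) →ₗ[ℝ] (E × E → ℝ) where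
  toFun u z := (u z.1 - u z.2) / ‖z.1 - z.2‖ ^ σ
  map_add' u v := by ext z; simp only [Pi.add_apply]; ring
  map_smul' c u := by ext z; simp only [Pi.smul_apply, smul_eq_mul, RingHom.id_apply]; ring

theorem diffQuotient_apply (σ : ℝ) (u : E → ℝ) (z : E × E) :
    diffQuotient σ u z = (u z.1 - u z.2) / ‖z.1 - z.2‖ ^ σ := rfl

theorem abs_diffQuotient (σ : ℝ) (u : E → ℝ) (z : E × E) :
    |diffQuotient σ u z| = |u z.1 - u z.2| / ‖z.1 - z.2‖ ^ σ := by
  rw [diffQuotient_apply, abs_div, abs_of_nonneg (Real.rpow_nonneg (norm_nonneg _) σ)]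

theorem abs_diffQuotient_le_of_abs_sub_le {u v : E → ℝ}
    (h : ∀ x y, |u x - u y| ≤ |v x - v y|) (z : E × E) :
    |diffQuotient σ u z| ≤ |diffQuotient σ v z| := by
  simp only [abs_diffQuotient]
  exact div_le_div_of_nonneg_right (h _ _) (by positivity)

theorem abs_sub_le_rpow_mul_abs_diffQuotient (hσ : 0 ≤ σ) {R : ℝ} (u : E → ℝ) {z : E × E}
    (hz : ‖z.1 - z.2‖ ≤ R) : |u z.1 - u z.2| ≤ R ^ σ * |diffQuotient σ u z| := by
  rcases eq_or_ne z.1 z.2 with h | h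
  · rw [h, sub_self, abs_zero]
    exact mul_nonneg (Real.rpow_nonneg ((norm_nonneg _).trans hz) σ) (abs_nonneg _)
  have hpos : 0 < ‖z.1 - z.2‖ := norm_pos_iff.2 (sub_ne_zero.2 h)
  rw [abs_diffQuotient, mul_div_left_comm]
  exact le_mul_of_one_le_right (abs_nonneg _)
    ((one_le_div (by positivity)).2 (Real.rpow_le_rpow hpos.le hz hσ))

theorem tendsto_diffQuotient {ι : Type*} {l : Filter ι} {u : ι → E → ℝ} {f : E → ℝ} {z : E × E}
    (h₁ : Tendsto (fun i => u i z.1) l (𝓝 (f z.1)))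
    (h₂ : Tendsto (fun i => u i z.2) l (𝓝 (f z.2))) :
    Tendsto (fun i => diffQuotient σ (u i) z) l (𝓝 (diffQuotient σ f z)) :=
  (h₁.sub h₂).div_const _

variable [MeasurableSpace E] {μ : Measure E}

theorem aestronglyMeasurable_diffQuotient [BorelSpace E] [SecondCountableTopology E] {u : E → ℝ}
    (hu : AEStronglyMeasurable u μ) : AEStronglyMeasurable (diffQuotient σ u) (μ.prod μ) := by
  have hdist : Measurable fun z : E × E => ‖z.1 - z.2‖ ^ σ := by fun_prop
  exact ((hu.comp_fst.sub hu.comp_snd).aemeasurable.div hdist.aemeasurable).aestronglyMeasurable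

end DifferenceQuotient

section LipschitzFunctions

open Module

variable {E : Type*} [NormedAddCommGroup E] {σ p : ℝ}

theorem exists_abs_sub_le_mul_min_one_norm {η : E → ℝ} {L : ℝ≥0}
    (hL : LipschitzWith L η) (hη : HasCompactSupport η) :
    ∃ B, 0 ≤ B ∧ ∀ x y, |η x - η y| ≤ B * min 1 ‖x - y‖ := by
  obtain ⟨M, hM⟩ := hL.continuous.bounded_above_of_compact_support hη
  refine ⟨max L (2 * M), L.2.trans (le_max_left _ _), fun x y => ?_⟩
  have hbounded : |η x - η y| ≤ 2 * M := by
    have hx := hM x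
    have hy := hM y
    rw [Real.norm_eq_abs] at hx hy
    linarith [abs_sub (η x) (η y)]
  have hlip : |η x - η y| ≤ L * ‖x - y‖ := by
    simpa only [Real.dist_eq, ← dist_eq_norm] using hL.dist_le_mul x y
  rcases min_cases 1 ‖x - y‖ with ⟨h, -⟩ | ⟨h, -⟩ <;> rw [h]
  · rw [mul_one]
    exact hbounded.trans (le_max_right _ _)
  · exact hlip.trans (mul_le_mul_of_nonneg_right (le_max_left _ _) (norm_nonneg _))

theorem abs_diffQuotient_rpow_le (hp : 0 < p) {η : E → ℝ} {B : ℝ} (hB0 : 0 ≤ B)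
    (hB : ∀ x y, |η x - η y| ≤ B * min 1 ‖x - y‖) (z : E × E) :
    |diffQuotient σ η z| ^ p ≤
      B ^ p * (((tsupport η).indicator 1 z.1 + (tsupport η).indicator 1 z.2) *
        (min 1 ‖z.1 - z.2‖ ^ p / ‖z.1 - z.2‖ ^ (σ * p))) := by
  have hind (x : E) : 0 ≤ (tsupport η).indicator (1 : E → ℝ) x :=
    indicator_nonneg (fun _ _ => zero_le_one) x
  by_cases hz : z.1 ∉ tsupport η ∧ z.2 ∉ tsupport η
  · rw [diffQuotient_apply, image_eq_zero_of_notMem_tsupport hz.1,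
      image_eq_zero_of_notMem_tsupport hz.2, sub_self, zero_div, abs_zero, Real.zero_rpow hp.ne']
    exact mul_nonneg (by positivity) (mul_nonneg (add_nonneg (hind _) (hind _)) (by positivity))
  have hone : 1 ≤ (tsupport η).indicator (1 : E → ℝ) z.1 + (tsupport η).indicator 1 z.2 := by
    by_cases h₁ : z.1 ∈ tsupport η
    · rw [indicator_of_mem h₁]
      exact le_add_of_nonneg_right (hind _)
    · rw [indicator_of_mem (not_not.1 fun h₂ => hz ⟨h₁, h₂⟩)]
      exact le_add_of_nonneg_left (hind _)
  calc |diffQuotient σ η z| ^ p = |η z.1 - η z.2| ^ p / ‖z.1 - z.2‖ ^ (σ * p) := by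
        rw [abs_diffQuotient, Real.div_rpow (abs_nonneg _) (by positivity),
          ← Real.rpow_mul (norm_nonneg _)]
    _ ≤ (B * min 1 ‖z.1 - z.2‖) ^ p / ‖z.1 - z.2‖ ^ (σ * p) := by gcongr; exact hB _ _
    _ = B ^ p * (min 1 ‖z.1 - z.2‖ ^ p / ‖z.1 - z.2‖ ^ (σ * p)) := by
        rw [Real.mul_rpow hB0 (by positivity), mul_div_assoc]
    _ ≤ _ := by gcongr; exact le_mul_of_one_le_left (by positivity) hone

variable [NormedSpace ℝ E] [FiniteDimensional ℝ E] [MeasurableSpace E] [BorelSpace E]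
  {μ : Measure E} [μ.IsAddHaarMeasure]

theorem integrable_indicator_fst_add_indicator_snd_mul {K : Set E} (hK : MeasurableSet K)
    (hKfin : μ K ≠ ⊤) {k : E → ℝ} (hk : Integrable k μ) (hneg : ∀ h, k (-h) = k h) :
    Integrable (fun z : E × E => (K.indicator 1 z.1 + K.indicator 1 z.2) * k (z.1 - z.2))
      (μ.prod μ) := by
  have hone : Integrable (K.indicator (1 : E → ℝ)) μ :=
    (integrable_indicator_iff hK).2 (integrableOn_const hKfin)
  have hsnd := hone.convolution_integrand (ContinuousLinearMap.mul ℝ ℝ) hk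
  refine (hsnd.swap.add hsnd).congr (.of_forall fun z => ?_)
  simp only [Pi.add_apply, Function.comp_apply, Prod.fst_swap, Prod.snd_swap,
    ContinuousLinearMap.mul_apply']
  rw [← neg_sub z.1 z.2, hneg, add_mul]

variable [Nontrivial E]

theorem integrable_min_one_norm_rpow_div (hσ : finrank ℝ E < σ) (hσp : σ < finrank ℝ E + p) :
    Integrable (fun h : E => min 1 ‖h‖ ^ p / ‖h‖ ^ σ) μ := by
  rw [integrable_fun_norm_addHaar μ (f := fun r => min 1 r ^ p / r ^ σ),
    ← Ioc_union_Ioi_eq_Ioi (zero_le_one' ℝ)]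
  have hpow {r : ℝ} (a : ℝ) (hr : 0 < r) :
      r ^ (finrank ℝ E - 1) * r ^ a = r ^ ((finrank ℝ E : ℝ) - 1 + a) := by
    rw [← Real.rpow_natCast, ← Real.rpow_add hr, Nat.cast_sub finrank_pos, Nat.cast_one]
  refine IntegrableOn.union ?_ ?_
  · have hnear : IntegrableOn (fun r : ℝ => r ^ ((finrank ℝ E : ℝ) - 1 + (p - σ))) (Ioc 0 1) :=
      (integrableOn_Ioc_iff_integrableOn_Ioo).2
        ((intervalIntegral.integrableOn_Ioo_rpow_iff one_pos).2 (by linarith))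
    refine hnear.congr_fun (fun r hr => ?_) measurableSet_Ioc
    rw [smul_eq_mul, min_eq_right hr.2, ← Real.rpow_sub hr.1, hpow _ hr.1]
  · have hfar : IntegrableOn (fun r : ℝ => r ^ ((finrank ℝ E : ℝ) - 1 + -σ)) (Ioi 1) :=
      integrableOn_Ioi_rpow_of_lt (by linarith) one_pos
    refine hfar.congr_fun (fun r hr => ?_) measurableSet_Ioi
    have hr0 : (0 : ℝ) < r := one_pos.trans hr
    rw [smul_eq_mul, min_eq_left hr.le, Real.one_rpow, one_div, ← Real.rpow_neg hr0.le, hpow _ hr0]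

theorem memLp_diffQuotient_of_lipschitzWith (hp : 0 < p) (hσ : finrank ℝ E < σ * p)
    (hσp : σ * p < finrank ℝ E + p) {η : E → ℝ} {L : ℝ≥0} (hL : LipschitzWith L η)
    (hη : HasCompactSupport η) : MemLp (diffQuotient σ η) (ENNReal.ofReal p) (μ.prod μ) := by
  have hmeas : AEStronglyMeasurable (diffQuotient σ η) (μ.prod μ) :=
    aestronglyMeasurable_diffQuotient hL.continuous.aestronglyMeasurable
  rw [← integrable_norm_rpow_iff hmeas (ENNReal.ofReal_pos.2 hp).ne' ENNReal.ofReal_ne_top,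
    ENNReal.toReal_ofReal hp.le]
  obtain ⟨B, hB0, hB⟩ := exists_abs_sub_le_mul_min_one_norm hL hη
  have hkernel := (integrable_indicator_fst_add_indicator_snd_mul (μ := μ)
    (isClosed_tsupport η).measurableSet hη.measure_lt_top.ne
    (integrable_min_one_norm_rpow_div hσ hσp) fun h => by simp only [norm_neg]).const_mul (B ^ p)
  refine hkernel.mono' (hmeas.norm.aemeasurable.pow_const p).aestronglyMeasurable
    (.of_forall fun z => ?_)
  rw [Real.norm_of_nonneg (by positivity), Real.norm_eq_abs]
  exact abs_diffQuotient_rpow_le hp hB0 hB z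

end LipschitzFunctions

/-! ### Functions vanishing off a set of finite measure -/

section Poincare

open Filter Topology

variable {E : Type*} [NormedAddCommGroup E] [MeasurableSpace E] [BorelSpace E] {μ : Measure E}
  [μ.IsAddHaarMeasure] {σ p : ℝ} {Ω : Set E}

/-- Every point has a ball of fixed radius which meets the complement of `Ω` in a set of measure
at least `m`; there `u` vanishes, and the difference quotient controls `u` itself. -/
theorem enorm_rpow_mul_le_lintegral_diffQuotient (hσ : 0 ≤ σ) (hp : 0 < p) {u : E → ℝ}
    (hu : ∀ᵐ x ∂μ, x ∉ Ω → u x = 0) {R : ℝ} (hR : 0 < R) {m : ℝ≥0∞}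
    (hm : m + μ Ω ≤ μ (Metric.ball 0 R)) (hΩ : μ Ω ≠ ⊤) (x : E) :
    ‖u x‖ₑ ^ p * m ≤ ENNReal.ofReal ((R ^ σ) ^ p) * ∫⁻ y, ‖diffQuotient σ u (x, y)‖ₑ ^ p ∂μ := by
  set A := Metric.ball x R \ toMeasurable μ Ω
  have hmA : m ≤ μ A := by
    refine le_trans ?_ (le_measure_sdiff (μ := μ))
    rw [measure_toMeasurable, Measure.addHaar_ball_center]
    exact ENNReal.le_sub_of_add_le_right hΩ hm
  have hAmeas : MeasurableSet A := measurableSet_ball.diff (measurableSet_toMeasurable μ Ω)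
  calc ‖u x‖ₑ ^ p * m ≤ ‖u x‖ₑ ^ p * μ A := by gcongr
    _ = ∫⁻ _ in A, ‖u x‖ₑ ^ p ∂μ := (setLIntegral_const ..).symm
    _ ≤ ∫⁻ y in A, ENNReal.ofReal ((R ^ σ) ^ p) * ‖diffQuotient σ u (x, y)‖ₑ ^ p ∂μ := by
      refine lintegral_mono_ae ((ae_restrict_iff' hAmeas).2 ?_)
      filter_upwards [hu] with y hy hyA
      have hvalue := abs_sub_le_rpow_mul_abs_diffQuotient hσ u (z := (x, y)) (R := R)
        (mem_ball_iff_norm'.1 hyA.1).le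
      rw [hy fun h => hyA.2 (subset_toMeasurable μ Ω h), sub_zero] at hvalue
      simp only [Real.enorm_eq_ofReal_abs, ENNReal.ofReal_rpow_of_nonneg (abs_nonneg _) hp.le]
      rw [← ENNReal.ofReal_mul (by positivity), ← Real.mul_rpow (by positivity) (abs_nonneg _)]
      gcongr
    _ ≤ ∫⁻ y, ENNReal.ofReal ((R ^ σ) ^ p) * ‖diffQuotient σ u (x, y)‖ₑ ^ p ∂μ :=
      setLIntegral_le_lintegral _ _
    _ = _ := lintegral_const_mul' _ _ ENNReal.ofReal_ne_top

variable [NormedSpace ℝ E] [FiniteDimensional ℝ E] [Nontrivial E]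

theorem exists_lt_measure_ball (μ : Measure E) [μ.IsAddHaarMeasure] {a : ℝ≥0∞}
    (ha : a ≠ ⊤) : ∃ R > 0, a < μ (Metric.ball 0 R) := by
  have hmono : Monotone fun n : ℕ => Metric.ball (0 : E) n := fun m n hmn =>
    Metric.ball_subset_ball (Nat.cast_le.2 hmn)
  have hlim := tendsto_measure_iUnion_atTop (μ := μ) hmono
  rw [Metric.iUnion_ball_nat, measure_univ_of_isAddLeftInvariant] at hlim
  obtain ⟨n, hn, hn0⟩ := ((hlim.eventually_const_lt ha.lt_top).and (eventually_gt_atTop 0)).exists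
  exact ⟨n, Nat.cast_pos.2 hn0, hn⟩

theorem exists_eLpNorm_le_mul_eLpNorm_diffQuotient (hσ : 0 ≤ σ) (hp : 0 < p)
    (hΩ : μ Ω ≠ ⊤) :
    ∃ C : ℝ≥0∞, C ≠ ⊤ ∧ ∀ u : E → ℝ, AEStronglyMeasurable u μ → (∀ᵐ x ∂μ, x ∉ Ω → u x = 0) →
      eLpNorm u (ENNReal.ofReal p) μ ≤
        C * eLpNorm (diffQuotient σ u) (ENNReal.ofReal p) (μ.prod μ) := by
  obtain ⟨R, hR, hlarge⟩ := exists_lt_measure_ball μ hΩ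
  set m := μ (Metric.ball 0 R) - μ Ω
  have hm0 : m ≠ 0 := (tsub_pos_of_lt hlarge).ne'
  have hmtop : m ≠ ⊤ := ENNReal.sub_ne_top measure_ball_lt_top.ne
  set c := ENNReal.ofReal ((R ^ σ) ^ p)
  refine ⟨(c / m) ^ (1 / p), ENNReal.rpow_ne_top_of_nonneg (by positivity)
    (ENNReal.div_ne_top ENNReal.ofReal_ne_top hm0), fun u humeas hu => ?_⟩
  simp only [eLpNorm_eq_lintegral_rpow_enorm_toReal (ENNReal.ofReal_pos.2 hp).ne'
    ENNReal.ofReal_ne_top, ENNReal.toReal_ofReal hp.le]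
  rw [← ENNReal.mul_rpow_of_nonneg _ _ (by positivity)]
  refine ENNReal.rpow_le_rpow ?_ (by positivity)
  rw [mul_comm, ← mul_div_assoc, ENNReal.le_div_iff_mul_le (.inl hm0) (.inl hmtop), mul_comm _ c]
  calc (∫⁻ x, ‖u x‖ₑ ^ p ∂μ) * m = ∫⁻ x, ‖u x‖ₑ ^ p * m ∂μ := (lintegral_mul_const' _ _ hmtop).symm
    _ ≤ ∫⁻ x, c * ∫⁻ y, ‖diffQuotient σ u (x, y)‖ₑ ^ p ∂μ ∂μ := lintegral_mono fun x =>
      enorm_rpow_mul_le_lintegral_diffQuotient hσ hp hu hR (tsub_add_cancel_of_le hlarge.le).le hΩ x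
    _ = c * ∫⁻ z, ‖diffQuotient σ u z‖ₑ ^ p ∂μ.prod μ := by
      rw [lintegral_const_mul' _ _ ENNReal.ofReal_ne_top, lintegral_prod _
        ((aestronglyMeasurable_diffQuotient humeas).enorm.pow_const p)]

end Poincare

section GagliardoSpace

open Filter Topology

variable {E : Type*} [NormedAddCommGroup E] [MeasurableSpace E] {μ : Measure E} {σ p : ℝ}
  {Ω : Set E}

/-- The functions on `E` that vanish almost everywhere outside `Ω` and have finite Gagliardo
seminorm, without identification of functions that agree almost everywhere. -/
noncomputable def gagliardoSpace (σ p : ℝ) (μ : Measure E) (Ω : Set E) : Submodule ℝ (E → ℝ) where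
  carrier := {u | AEStronglyMeasurable u μ ∧ (∀ᵐ x ∂μ, x ∉ Ω → u x = 0) ∧
    MemLp (diffQuotient σ u) (ENNReal.ofReal p) (μ.prod μ)}
  zero_mem' := ⟨aestronglyMeasurable_zero, .of_forall fun _ _ => rfl, by
    rw [map_zero]; exact MemLp.zero⟩
  add_mem' {u v} hu hv := ⟨hu.1.add hv.1, by
    filter_upwards [hu.2.1, hv.2.1] with x hx hy hxΩ
    rw [Pi.add_apply, hx hxΩ, hy hxΩ, add_zero], by
    rw [map_add]; exact hu.2.2.add hv.2.2⟩
  smul_mem' c u hu := ⟨hu.1.const_smul c, by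
    filter_upwards [hu.2.1] with x hx hxΩ
    rw [Pi.smul_apply, hx hxΩ, smul_zero], by
    rw [map_smul]; exact hu.2.2.const_smul c⟩

/-- The difference quotient as a linear map from the Gagliardo space to `L^p`, whose norm there is
the Gagliardo seminorm. -/
noncomputable def diffQuotientLp (σ p : ℝ) (μ : Measure E) (Ω : Set E) :
    gagliardoSpace σ p μ Ω →ₗ[ℝ] Lp ℝ (ENNReal.ofReal p) (μ.prod μ) where
  toFun u := MemLp.toLp _ u.2.2.2
  map_add' u v := by
    rw [← MemLp.toLp_add]
    exact MemLp.toLp_congr _ _ (.of_eq (map_add _ _ _))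
  map_smul' c u := by
    rw [RingHom.id_apply, ← MemLp.toLp_const_smul]
    exact MemLp.toLp_congr _ _ (.of_eq (map_smul _ _ _))

theorem coeFn_diffQuotientLp (u : gagliardoSpace σ p μ Ω) :
    diffQuotientLp σ p μ Ω u =ᵐ[μ.prod μ] diffQuotient σ (u : E → ℝ) :=
  MemLp.coeFn_toLp u.2.2.2

theorem norm_diffQuotientLp (u : gagliardoSpace σ p μ Ω) :
    ‖diffQuotientLp σ p μ Ω u‖ =
      (eLpNorm (diffQuotient σ (u : E → ℝ)) (ENNReal.ofReal p) (μ.prod μ)).toReal :=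
  Lp.norm_toLp _ u.2.2.2

theorem norm_diffQuotientLp_le_of_abs_sub_le {u v : gagliardoSpace σ p μ Ω}
    (h : ∀ x y, |(u : E → ℝ) x - (u : E → ℝ) y| ≤ |(v : E → ℝ) x - (v : E → ℝ) y|) :
    ‖diffQuotientLp σ p μ Ω u‖ ≤ ‖diffQuotientLp σ p μ Ω v‖ := by
  rw [norm_diffQuotientLp, norm_diffQuotientLp]
  exact ENNReal.toReal_mono v.2.2.2.2.ne (eLpNorm_mono (abs_diffQuotient_le_of_abs_sub_le h))

theorem abs_mem_gagliardoSpace [BorelSpace E] [SecondCountableTopology E] {u : E → ℝ}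
    (hu : u ∈ gagliardoSpace σ p μ Ω) : |u| ∈ gagliardoSpace σ p μ Ω := by
  refine ⟨hu.1.norm, ?_, hu.2.2.mono (aestronglyMeasurable_diffQuotient hu.1.norm)
    (.of_forall (abs_diffQuotient_le_of_abs_sub_le fun x y => abs_abs_sub_abs_le _ _))⟩
  filter_upwards [hu.2.1] with x hx hxΩ
  rw [Pi.abs_apply, hx hxΩ, abs_zero]

variable [NormedSpace ℝ E] [FiniteDimensional ℝ E] [Nontrivial E] [BorelSpace E]
  [μ.IsAddHaarMeasure]

theorem memLp_of_mem_gagliardoSpace (hσ : 0 ≤ σ) (hp : 0 < p) (hΩ : μ Ω ≠ ⊤) {u : E → ℝ}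
    (hu : u ∈ gagliardoSpace σ p μ Ω) : MemLp u (ENNReal.ofReal p) μ := by
  obtain ⟨C, hC, hbound⟩ := exists_eLpNorm_le_mul_eLpNorm_diffQuotient hσ hp hΩ
  exact ⟨hu.1, (hbound u hu.1 hu.2.1).trans_lt (ENNReal.mul_lt_top hC.lt_top hu.2.2.2)⟩

theorem exists_eLpNorm_toReal_le_mul_norm_diffQuotientLp (hσ : 0 ≤ σ) (hp : 0 < p)
    (hΩ : μ Ω ≠ ⊤) : ∃ C : ℝ, ∀ u : gagliardoSpace σ p μ Ω,
      (eLpNorm (u : E → ℝ) (ENNReal.ofReal p) μ).toReal ≤ C * ‖diffQuotientLp σ p μ Ω u‖ := by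
  obtain ⟨C, hC, hbound⟩ := exists_eLpNorm_le_mul_eLpNorm_diffQuotient (μ := μ) hσ hp hΩ
  refine ⟨C.toReal, fun u => ?_⟩
  rw [norm_diffQuotientLp, ← ENNReal.toReal_mul]
  exact ENNReal.toReal_mono (ENNReal.mul_ne_top hC u.2.2.2.2.ne) (hbound u u.2.1 u.2.2.1)

theorem ae_eq_of_diffQuotientLp_eq (hσ : 0 ≤ σ) (hp : 0 < p) (hΩ : μ Ω ≠ ⊤)
    {u v : gagliardoSpace σ p μ Ω}
    (h : diffQuotientLp σ p μ Ω u = diffQuotientLp σ p μ Ω v) : (u : E → ℝ) =ᵐ[μ] v := by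
  obtain ⟨C, hC⟩ := exists_eLpNorm_toReal_le_mul_norm_diffQuotientLp (μ := μ) (σ := σ) hσ hp hΩ
  have hnorm := hC (u - v)
  rw [map_sub, h, sub_self, Lp.norm_zero, mul_zero] at hnorm
  have hmem := memLp_of_mem_gagliardoSpace hσ hp hΩ (u - v).2
  have hzero := (ENNReal.toReal_eq_zero_iff _).1 (le_antisymm hnorm ENNReal.toReal_nonneg)
  rw [or_iff_left hmem.2.ne, eLpNorm_eq_zero_iff hmem.1 (ENNReal.ofReal_pos.2 hp).ne'] at hzero
  filter_upwards [hzero] with x hx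
  exact sub_eq_zero.1 hx

theorem integrableOn_of_mem_gagliardoSpace (hσ : 0 ≤ σ) (hp : 1 ≤ p) (hΩ : μ Ω ≠ ⊤) {u : E → ℝ}
    (hu : u ∈ gagliardoSpace σ p μ Ω) : IntegrableOn u Ω μ := by
  have : IsFiniteMeasure (μ.restrict Ω) := isFiniteMeasure_restrict.2 hΩ
  exact ((memLp_of_mem_gagliardoSpace hσ (by linarith) hΩ hu).restrict Ω).integrable
    (ENNReal.one_le_ofReal.2 hp)

theorem exists_abs_setIntegral_le_mul_norm_diffQuotientLp (hσ : 0 ≤ σ) (hp : 1 ≤ p)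
    (hΩ : μ Ω ≠ ⊤) : ∃ C : ℝ, ∀ u : gagliardoSpace σ p μ Ω,
      |∫ x in Ω, (u : E → ℝ) x ∂μ| ≤ C * ‖diffQuotientLp σ p μ Ω u‖ := by
  obtain ⟨C, hC⟩ := exists_eLpNorm_toReal_le_mul_norm_diffQuotientLp (μ := μ) hσ
    (by linarith : 0 < p) hΩ
  set M := μ.restrict Ω univ ^ (1 - 1 / p)
  have hMtop : M ≠ ⊤ := ENNReal.rpow_ne_top_of_nonneg
    (sub_nonneg.2 ((div_le_one (by linarith)).2 hp)) (by rwa [Measure.restrict_apply_univ])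
  refine ⟨C * M.toReal, fun u => ?_⟩
  have hu := memLp_of_mem_gagliardoSpace hσ (by linarith) hΩ u.2
  have hholder : ∫⁻ x in Ω, ‖(u : E → ℝ) x‖ₑ ∂μ ≤
      eLpNorm (u : E → ℝ) (ENNReal.ofReal p) μ * M := by
    rw [← eLpNorm_one_eq_lintegral_enorm]
    refine (eLpNorm_le_eLpNorm_mul_rpow_measure_univ (ENNReal.one_le_ofReal.2 hp)
      hu.1.restrict).trans ?_
    rw [ENNReal.toReal_one, ENNReal.toReal_ofReal (by linarith), div_one]
    gcongr
    exact Measure.restrict_le_self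
  calc |∫ x in Ω, (u : E → ℝ) x ∂μ| ≤ (∫⁻ x in Ω, ‖(u : E → ℝ) x‖ₑ ∂μ).toReal := by
        simp only [← Real.norm_eq_abs, ← ofReal_norm]
        exact norm_integral_le_lintegral_norm _
    _ ≤ (eLpNorm (u : E → ℝ) (ENNReal.ofReal p) μ * M).toReal :=
        ENNReal.toReal_mono (ENNReal.mul_ne_top hu.2.ne hMtop) hholder
    _ ≤ C * M.toReal * ‖diffQuotientLp σ p μ Ω u‖ := by
        rw [ENNReal.toReal_mul, mul_right_comm]
        exact mul_le_mul_of_nonneg_right (hC u) ENNReal.toReal_nonneg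

variable [Fact (1 ≤ ENNReal.ofReal p)]

theorem exists_subseq_tendsto_ae_of_cauchySeq (hσ : 0 ≤ σ) (hp : 0 < p) (hΩ : μ Ω ≠ ⊤)
    {u : ℕ → gagliardoSpace σ p μ Ω} (hu : CauchySeq fun n => diffQuotientLp σ p μ Ω (u n)) :
    ∃ (f : E → ℝ) (ns : ℕ → ℕ), AEStronglyMeasurable f μ ∧ StrictMono ns ∧
      ∀ᵐ x ∂μ, Tendsto (fun k => (u (ns k) : E → ℝ) x) atTop (𝓝 (f x)) := by
  obtain ⟨C, hC⟩ := exists_eLpNorm_toReal_le_mul_norm_diffQuotientLp (μ := μ) (σ := σ) hσ hp hΩ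
  have hmem (n : ℕ) := memLp_of_mem_gagliardoSpace hσ hp hΩ (u n).2
  have hcauchy : CauchySeq fun n => (hmem n).toLp := by
    rw [cauchySeq_iff_tendsto_dist_atTop_0] at hu ⊢
    refine squeeze_zero (fun _ => dist_nonneg) (fun n => ?_) (by simpa using hu.const_mul C)
    rw [dist_eq_norm, dist_eq_norm, ← map_sub, ← MemLp.toLp_sub, Lp.norm_toLp]
    exact hC (u n.1 - u n.2)
  obtain ⟨f, hf⟩ := cauchySeq_tendsto_of_complete hcauchy
  obtain ⟨ns, hns, hlim⟩ := (tendstoInMeasure_of_tendsto_Lp hf).exists_seq_tendsto_ae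
  refine ⟨f, ns, Lp.aestronglyMeasurable f, hns, ?_⟩
  filter_upwards [hlim, ae_all_iff.2 fun n => (hmem n).coeFn_toLp] with x hx hcoe
  simpa only [hcoe] using hx

theorem exists_subseq_tendsto_ae_of_tendsto_diffQuotientLp (hσ : 0 ≤ σ) (hp : 0 < p)
    (hΩ : μ Ω ≠ ⊤) {u : ℕ → gagliardoSpace σ p μ Ω} {g : Lp ℝ (ENNReal.ofReal p) (μ.prod μ)}
    (hg : Tendsto (fun n => diffQuotientLp σ p μ Ω (u n)) atTop (𝓝 g)) :
    ∃ (w : gagliardoSpace σ p μ Ω) (ns : ℕ → ℕ), diffQuotientLp σ p μ Ω w = g ∧ StrictMono ns ∧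
      ∀ᵐ x ∂μ, Tendsto (fun k => (u (ns k) : E → ℝ) x) atTop (𝓝 ((w : E → ℝ) x)) := by
  obtain ⟨f, ns, hfmeas, hns, hf⟩ := exists_subseq_tendsto_ae_of_cauchySeq hσ hp hΩ hg.cauchySeq
  obtain ⟨ms, hms, hgae⟩ :=
    (tendstoInMeasure_of_tendsto_Lp (hg.comp hns.tendsto_atTop)).exists_seq_tendsto_ae
  have hquotient : g =ᵐ[μ.prod μ] diffQuotient σ f := by
    filter_upwards [hgae, ae_all_iff.2 fun n => coeFn_diffQuotientLp (u n),
      Measure.quasiMeasurePreserving_fst.ae hf, Measure.quasiMeasurePreserving_snd.ae hf]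
      with z hz hcoe h₁ h₂
    simp only [Function.comp_apply, hcoe] at hz
    exact tendsto_nhds_unique hz
      (tendsto_diffQuotient (h₁.comp hms.tendsto_atTop) (h₂.comp hms.tendsto_atTop))
  have hzero : ∀ᵐ x ∂μ, x ∉ Ω → f x = 0 := by
    filter_upwards [hf, ae_all_iff.2 fun n => (u n).2.2.1] with x hx hu0 hxΩ
    refine tendsto_nhds_unique hx ?_
    simp only [hu0 _ hxΩ, tendsto_const_nhds]
  refine ⟨⟨f, hfmeas, hzero, (Lp.memLp g).ae_eq hquotient⟩, ns, Lp.ext ?_, hns, hf⟩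
  exact (coeFn_diffQuotientLp _).trans hquotient.symm

theorem isClosed_range_diffQuotientLp (hσ : 0 ≤ σ) (hp : 0 < p) (hΩ : μ Ω ≠ ⊤) :
    IsClosed (range (diffQuotientLp σ p μ Ω)) := by
  refine IsSeqClosed.isClosed fun F g hF hg => ?_
  choose u hu using hF
  obtain rfl : (fun n => diffQuotientLp σ p μ Ω (u n)) = F := funext hu
  obtain ⟨w, -, hw, -⟩ := exists_subseq_tendsto_ae_of_tendsto_diffQuotientLp hσ hp hΩ hg
  exact ⟨w, hw⟩

theorem exists_subseq_tendsto_ae (hσ : 0 ≤ σ) (hp : 0 < p) (hΩ : μ Ω ≠ ⊤)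
    {u : ℕ → gagliardoSpace σ p μ Ω} {w : gagliardoSpace σ p μ Ω}
    (hw : Tendsto (fun n => diffQuotientLp σ p μ Ω (u n)) atTop
      (𝓝 (diffQuotientLp σ p μ Ω w))) :
    ∃ ns : ℕ → ℕ, StrictMono ns ∧
      ∀ᵐ x ∂μ, Tendsto (fun k => (u (ns k) : E → ℝ) x) atTop (𝓝 ((w : E → ℝ) x)) := by
  obtain ⟨w', ns, hw', hns, hlim⟩ := exists_subseq_tendsto_ae_of_tendsto_diffQuotientLp hσ hp hΩ hw
  refine ⟨ns, hns, ?_⟩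
  filter_upwards [hlim, ae_eq_of_diffQuotientLp_eq hσ hp hΩ hw'] with x hx hxw
  rwa [← hxw]

end GagliardoSpace

/-! ### The space `W_0^{s,p}` as a subspace of the Gagliardo space -/

section SobolevZero

open Filter Topology

variable {N : ℕ} {s p : ℝ} {Ω : Set (EuclideanSpace ℝ (Fin N))}

local notation "𝔼" => EuclideanSpace ℝ (Fin N)

/-- The order of the difference quotient whose `L^p` norm is `[·]_{s,p}` in dimension `N`. -/
noncomputable def diffOrder (N : ℕ) (s p : ℝ) : ℝ := (N + s * p) / p

theorem diffOrder_mul (N : ℕ) (s : ℝ) (hp : 0 < p) : diffOrder N s p * p = N + s * p :=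
  div_mul_cancel₀ _ hp.ne'

theorem diffOrder_nonneg (N : ℕ) (hs : 0 ≤ s) (hp : 0 < p) : 0 ≤ diffOrder N s p := by
  unfold diffOrder; positivity

theorem gagliardoSeminorm_eq_eLpNorm (s : ℝ) (hp : 0 < p) (u : 𝔼 → ℝ) :
    gagliardoSeminorm s p u =
      eLpNorm (diffQuotient (diffOrder N s p) u) (ENNReal.ofReal p) (volume.prod volume) := by
  rw [eLpNorm_eq_lintegral_rpow_enorm_toReal (ENNReal.ofReal_pos.2 hp).ne' ENNReal.ofReal_ne_top,
    ENNReal.toReal_ofReal hp.le]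
  refine congrArg (· ^ (1 / p)) (lintegral_congr fun z => ?_)
  rw [Real.enorm_eq_ofReal_abs, ENNReal.ofReal_rpow_of_nonneg (abs_nonneg _) hp.le,
    abs_diffQuotient, Real.div_rpow (abs_nonneg _) (Real.rpow_nonneg (norm_nonneg _) _),
    ← Real.rpow_mul (norm_nonneg _), diffOrder_mul N s hp]

theorem fracPLaplacePairing_eq_dualityPairing (s : ℝ) (hp : 0 < p) (u v : 𝔼 → ℝ) :
    fracPLaplacePairing s p u v = dualityPairing p (volume.prod volume)
      (diffQuotient (diffOrder N s p) u) (diffQuotient (diffOrder N s p) v) := by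
  refine integral_congr_ae (.of_forall fun z => ?_)
  simp only [diffQuotient_apply, ← diffOrder_mul N s hp]
  rcases eq_or_ne z.1 z.2 with h | h
  · simp only [h, sub_self, mul_zero, zero_div]
  have hz : 0 < ‖z.1 - z.2‖ := norm_pos_iff.2 (sub_ne_zero.2 h)
  set k := ‖z.1 - z.2‖ ^ diffOrder N s p
  have hkpos : 0 < k := Real.rpow_pos_of_pos hz _
  have hkp : ‖z.1 - z.2‖ ^ (diffOrder N s p * p) = k ^ (p - 2) * k * k := by
    rw [← Real.rpow_add_one hkpos.ne', ← Real.rpow_add_one hkpos.ne', Real.rpow_mul hz.le]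
    congr 1; ring
  rw [hkp, abs_div, abs_of_pos hkpos, Real.div_rpow (abs_nonneg _) hkpos.le]
  have : 0 < k ^ (p - 2) := by positivity
  field_simp

/-- The space `C_0^∞(Ω)` of test functions. -/
def testFunctions (Ω : Set 𝔼) : Submodule ℝ (𝔼 → ℝ) where
  carrier := {η | IsTestFunction Ω η}
  zero_mem' := ⟨contDiff_const, .zero, by simp [tsupport]⟩
  add_mem' {η ζ} hη hζ := ⟨hη.1.add hζ.1, hη.2.1.add hζ.2.1,
    (tsupport_add η ζ).trans (union_subset hη.2.2 hζ.2.2)⟩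
  smul_mem' c η hη := ⟨contDiff_const.smul hη.1, hη.2.1.smul_left (f := fun _ => c),
    (tsupport_smul_subset_right (fun _ => c) η).trans hη.2.2⟩

theorem IsTestFunction.mem_gagliardoSpace [NeZero N] (hs0 : 0 < s) (hs1 : s < 1) (hp : 0 < p)
    {η : 𝔼 → ℝ} (hη : IsTestFunction Ω η) : η ∈ gagliardoSpace (diffOrder N s p) p volume Ω := by
  obtain ⟨L, hL⟩ := hη.1.lipschitzWith_of_hasCompactSupport hη.2.1 (by simp)
  refine ⟨hη.1.continuous.aestronglyMeasurable, .of_forall fun x hx =>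
    image_eq_zero_of_notMem_tsupport fun h => hx (hη.2.2 h),
    memLp_diffQuotient_of_lipschitzWith hp ?_ ?_ hL hη.2.1⟩ <;>
  rw [diffOrder_mul N s hp, finrank_euclideanSpace_fin]
  · exact lt_add_of_pos_right _ (mul_pos hs0 hp)
  · gcongr
    exact mul_lt_of_lt_one_left hp hs1

theorem edist_diffQuotientLp (hp : 0 < p)
    (u v : gagliardoSpace (diffOrder N s p) p volume Ω) :
    edist (diffQuotientLp _ p volume Ω u) (diffQuotientLp _ p volume Ω v) =
      gagliardoSeminorm s p (u - v : 𝔼 → ℝ) := by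
  rw [gagliardoSeminorm_eq_eLpNorm s hp, map_sub]
  exact Lp.edist_toLp_toLp _ _ u.2.2.2 v.2.2.2

theorem MemW0.mem_gagliardoSpace [NeZero N] (hs0 : 0 < s) (hs1 : s < 1) (hp : 0 < p)
    {u : 𝔼 → ℝ} (hu : MemW0 s p Ω u) : u ∈ gagliardoSpace (diffOrder N s p) p volume Ω := by
  obtain ⟨η, hη, hlt⟩ := hu.approx 1 one_pos
  have hη' := hη.mem_gagliardoSpace hs0 hs1 hp
  have hdiff : MemLp (diffQuotient (diffOrder N s p) (u - η)) (ENNReal.ofReal p)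
      (volume.prod volume) :=
    ⟨aestronglyMeasurable_diffQuotient (hu.aestronglyMeasurable.sub hη'.1),
      gagliardoSeminorm_eq_eLpNorm s hp (u - η) ▸
        (le_self_add.trans_lt hlt).trans ENNReal.one_lt_top⟩
  refine ⟨hu.aestronglyMeasurable, hu.ae_eq_zero, ?_⟩
  rw [← sub_add_cancel u η, map_add]
  exact hdiff.add hη'.2.2

variable [Fact (1 ≤ ENNReal.ofReal p)]

/-- The space `W_0^{s,p}(Ω)` as the closure of the test functions for the Gagliardo seminorm
alone. By the Poincaré inequality the `L^p` norm in the paper's definition is redundant. -/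
noncomputable def sobolevZero (s p : ℝ) [Fact (1 ≤ ENNReal.ofReal p)] (Ω : Set 𝔼) :
    Submodule ℝ (𝔼 → ℝ) :=
  ((((testFunctions Ω).comap (gagliardoSpace (diffOrder N s p) p volume Ω).subtype).map
    (diffQuotientLp ..)).topologicalClosure.comap (diffQuotientLp ..)).map
    (gagliardoSpace (diffOrder N s p) p volume Ω).subtype

theorem sobolevZero_le_gagliardoSpace (s p : ℝ) [Fact (1 ≤ ENNReal.ofReal p)] (Ω : Set 𝔼) :
    sobolevZero s p Ω ≤ gagliardoSpace (diffOrder N s p) p volume Ω :=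
  Submodule.map_subtype_le _ _

/-- The restriction of the difference quotient to `W_0^{s,p}(Ω)`. -/
noncomputable def sobolevQuotient (s p : ℝ) [Fact (1 ≤ ENNReal.ofReal p)] (Ω : Set 𝔼) :
    sobolevZero s p Ω →ₗ[ℝ] Lp ℝ (ENNReal.ofReal p)
      ((volume : Measure 𝔼).prod (volume : Measure 𝔼)) :=
  diffQuotientLp (diffOrder N s p) p volume Ω ∘ₗ
    Submodule.inclusion (sobolevZero_le_gagliardoSpace s p Ω)

theorem mem_sobolevZero_iff_exists_tendsto {u : 𝔼 → ℝ} :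
    u ∈ sobolevZero s p Ω ↔ ∃ (hu : u ∈ gagliardoSpace (diffOrder N s p) p volume Ω)
      (η : ℕ → gagliardoSpace (diffOrder N s p) p volume Ω),
      (∀ n, IsTestFunction Ω (η n : 𝔼 → ℝ)) ∧
        Tendsto (fun n => diffQuotientLp _ p volume Ω (η n)) atTop
          (𝓝 (diffQuotientLp _ p volume Ω ⟨u, hu⟩)) := by
  constructor
  · rintro ⟨w, hw, rfl⟩
    obtain ⟨F, hF, hlim⟩ := mem_closure_iff_seq_limit.1 hw
    choose η hη hηF using hF
    exact ⟨w.2, η, hη, (funext hηF : (fun n => diffQuotientLp _ p volume Ω (η n)) = F) ▸ hlim⟩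
  · rintro ⟨hu, η, hη, hlim⟩
    exact ⟨⟨u, hu⟩, mem_closure_iff_seq_limit.2 ⟨_, fun n => ⟨η n, hη n, rfl⟩, hlim⟩, rfl⟩

theorem mem_sobolevZero_iff [NeZero N] (hs0 : 0 < s) (hs1 : s < 1) (hp : 0 < p) {u : 𝔼 → ℝ} :
    u ∈ sobolevZero s p Ω ↔ u ∈ gagliardoSpace (diffOrder N s p) p volume Ω ∧
      ∀ ε > 0, ∃ η, IsTestFunction Ω η ∧ gagliardoSeminorm s p (u - η) < ε := by
  constructor
  · rintro ⟨w, hw, rfl⟩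
    refine ⟨w.2, fun ε hε => ?_⟩
    obtain ⟨_, ⟨η, hη, rfl⟩, hlt⟩ := EMetric.mem_closure_iff.1 hw ε hε
    exact ⟨η, hη, edist_diffQuotientLp hp w η ▸ hlt⟩
  · rintro ⟨hu, happrox⟩
    refine ⟨⟨u, hu⟩, EMetric.mem_closure_iff.2 fun ε hε => ?_, rfl⟩
    obtain ⟨η, hη, hlt⟩ := happrox ε hε
    let η' : gagliardoSpace (diffOrder N s p) p volume Ω := ⟨η, hη.mem_gagliardoSpace hs0 hs1 hp⟩
    exact ⟨_, ⟨η', hη, rfl⟩, (edist_diffQuotientLp hp ⟨u, hu⟩ η').trans_lt hlt⟩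

theorem memW0_iff_mem_sobolevZero [NeZero N] (hs0 : 0 < s) (hs1 : s < 1) (hp : 0 < p)
    (hΩ : volume Ω ≠ ⊤) {u : 𝔼 → ℝ} : MemW0 s p Ω u ↔ u ∈ sobolevZero s p Ω := by
  have hσ := diffOrder_nonneg N hs0.le hp
  rw [mem_sobolevZero_iff hs0 hs1 hp]
  constructor
  · refine fun hu => ⟨hu.mem_gagliardoSpace hs0 hs1 hp, fun ε hε => ?_⟩
    obtain ⟨η, hη, hlt⟩ := hu.approx ε hε
    exact ⟨η, hη, le_self_add.trans_lt hlt⟩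
  · rintro ⟨hu, happrox⟩
    refine ⟨hu.1, hu.2.1, fun ε hε => ?_⟩
    obtain ⟨C, hC, hbound⟩ :=
      exists_eLpNorm_le_mul_eLpNorm_diffQuotient (μ := volume) hσ hp hΩ
    have hC' : 1 + C ≠ ⊤ := ENNReal.add_ne_top.2 ⟨ENNReal.one_ne_top, hC⟩
    obtain ⟨η, hη, hlt⟩ := happrox (ε / (1 + C)) (ENNReal.div_pos hε.ne' hC')
    have hdiff := sub_mem hu (hη.mem_gagliardoSpace hs0 hs1 hp)
    refine ⟨η, hη, lt_of_le_of_lt ?_ (ENNReal.mul_lt_of_lt_div' hlt)⟩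
    rw [add_mul, one_mul]
    refine add_le_add_right ((eLpNorm_mono_measure _ Measure.restrict_le_self).trans ?_) _
    rw [gagliardoSeminorm_eq_eLpNorm s hp]
    exact hbound _ hdiff.1 hdiff.2.1

end SobolevZero

section AbsoluteValue

open Filter Topology

variable {N : ℕ} {s p : ℝ} {Ω : Set (EuclideanSpace ℝ (Fin N))}

local notation "𝔼" => EuclideanSpace ℝ (Fin N)

theorem abs_sqrt_sq_add_sq_sub_le (a b δ : ℝ) :
    |√(a ^ 2 + δ ^ 2) - √(b ^ 2 + δ ^ 2)| ≤ |a - b| := by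
  rw [← sq_le_sq]
  have ha := Real.sq_sqrt (show 0 ≤ a ^ 2 + δ ^ 2 by positivity)
  have hb := Real.sq_sqrt (show 0 ≤ b ^ 2 + δ ^ 2 by positivity)
  have hab : a * b + δ ^ 2 ≤ √(a ^ 2 + δ ^ 2) * √(b ^ 2 + δ ^ 2) := by
    rw [← Real.sqrt_mul (by positivity)]
    exact Real.le_sqrt_of_sq_le (by nlinarith [sq_nonneg (δ * (a - b))])
  nlinarith

theorem tendsto_sqrt_sq_add_sq_sub {ι : Type*} {l : Filter ι} {a δ : ι → ℝ} {b : ℝ}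
    (ha : Tendsto a l (𝓝 b)) (hδ : Tendsto δ l (𝓝 0)) :
    Tendsto (fun i => √(a i ^ 2 + δ i ^ 2) - δ i) l (𝓝 |b|) := by
  have h := ((ha.pow 2).add (hδ.pow 2)).sqrt.sub hδ
  rwa [zero_pow two_ne_zero, add_zero, sub_zero, Real.sqrt_sq_eq_abs] at h

theorem IsTestFunction.sqrt_sq_add_sq_sub {η : 𝔼 → ℝ} (hη : IsTestFunction Ω η) {δ : ℝ}
    (hδ : 0 < δ) : IsTestFunction Ω (fun x => √(η x ^ 2 + δ ^ 2) - δ) := by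
  have h0 : √((0 : ℝ) ^ 2 + δ ^ 2) - δ = 0 := by
    rw [zero_pow two_ne_zero, zero_add, Real.sqrt_sq hδ.le, sub_self]
  refine ⟨?_, hη.2.1.comp_left (g := fun t : ℝ => √(t ^ 2 + δ ^ 2) - δ) h0,
    (tsupport_comp_subset (g := fun t : ℝ => √(t ^ 2 + δ ^ 2) - δ) h0 η).trans hη.2.2⟩
  exact (((hη.1.pow 2).add contDiff_const).sqrt fun x => by positivity).sub contDiff_const

variable [NeZero N] [Fact (1 ≤ ENNReal.ofReal p)]

/-- The absolute value is not smooth, so test functions `η n` are first replaced by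
`√(η n ^ 2 + δ n ^ 2) - δ n`, whose difference quotients are dominated by those of `η n`. -/
theorem abs_mem_sobolevZero (hs0 : 0 < s) (hs1 : s < 1) (hp : 0 < p) (hΩ : volume Ω ≠ ⊤)
    {u : 𝔼 → ℝ} (hu : u ∈ sobolevZero s p Ω) : |u| ∈ sobolevZero s p Ω := by
  obtain ⟨hgag, η, hη, hlim⟩ := mem_sobolevZero_iff_exists_tendsto.1 hu
  obtain ⟨ns, hns, hae⟩ := exists_subseq_tendsto_ae (diffOrder_nonneg N hs0.le hp) hp hΩ hlim
  let δ : ℕ → ℝ := fun n => 1 / ((n : ℝ) + 1)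
  have hψ (n : ℕ) := (hη (ns n)).sqrt_sq_add_sq_sub (δ := δ n) Nat.one_div_pos_of_nat
  let ψ (n : ℕ) : gagliardoSpace (diffOrder N s p) p volume Ω :=
    ⟨_, (hψ n).mem_gagliardoSpace hs0 hs1 hp⟩
  refine mem_sobolevZero_iff_exists_tendsto.2 ⟨abs_mem_gagliardoSpace hgag, ψ, hψ, ?_⟩
  have hη_lim := (Lp.tendsto_Lp_iff_tendsto_eLpNorm'' _ (fun n => (η (ns n)).2.2.2) _ hgag.2.2).1
    (hlim.comp hns.tendsto_atTop)
  refine (Lp.tendsto_Lp_iff_tendsto_eLpNorm'' _ (fun n => (ψ n).2.2.2) _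
    (abs_mem_gagliardoSpace hgag).2.2).2 ?_
  refine tendsto_eLpNorm_sub_of_norm_le Fact.out ENNReal.ofReal_ne_top
    (fun n => (η (ns n)).2.2.2) hgag.2.2 hη_lim (fun n => (ψ n).2.2.2.1)
    (abs_mem_gagliardoSpace hgag).2.2 (fun n => abs_diffQuotient_le_of_abs_sub_le fun x y => ?_) ?_
  · simpa only [ψ, sub_sub_sub_cancel_right] using abs_sqrt_sq_add_sq_sub_le _ _ _
  · filter_upwards [Measure.quasiMeasurePreserving_fst.ae hae,
      Measure.quasiMeasurePreserving_snd.ae hae] with z h₁ h₂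
    have hδ := tendsto_one_div_add_atTop_nhds_zero_nat (𝕜 := ℝ)
    exact tendsto_diffQuotient (tendsto_sqrt_sq_add_sq_sub h₁ hδ) (tendsto_sqrt_sq_add_sq_sub h₂ hδ)

end AbsoluteValue

section SobolevQuotient

variable {N : ℕ} {s p : ℝ} {Ω : Set (EuclideanSpace ℝ (Fin N))}

local notation "𝔼" => EuclideanSpace ℝ (Fin N)

theorem exists_isTestFunction_integral_pos (hΩ : IsOpen Ω) (hne : Ω.Nonempty) :
    ∃ η : 𝔼 → ℝ, IsTestFunction Ω η ∧ 0 < ∫ x in Ω, η x := by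
  obtain ⟨x, hx⟩ := hne
  obtain ⟨r, hr, hball⟩ := Metric.nhds_basis_closedBall.mem_iff.1 (hΩ.mem_nhds hx)
  let b : ContDiffBump x := ⟨r / 2, r, by positivity, by linarith⟩
  have hsupp : tsupport b ⊆ Ω := b.tsupport_eq.trans_subset hball
  refine ⟨b, ⟨b.contDiff, b.hasCompactSupport, hsupp⟩, ?_⟩
  rw [setIntegral_eq_integral_of_forall_compl_eq_zero fun y hy =>
    image_eq_zero_of_notMem_tsupport fun h => hy (hsupp h)]
  exact b.integral_pos

variable [Fact (1 ≤ ENNReal.ofReal p)]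

theorem coeFn_sobolevQuotient (u : sobolevZero s p Ω) :
    sobolevQuotient s p Ω u =ᵐ[volume.prod volume] diffQuotient (diffOrder N s p) (u : 𝔼 → ℝ) :=
  coeFn_diffQuotientLp _

theorem gagliardoSeminorm_rpow_eq (hp : 0 < p) (u : sobolevZero s p Ω) :
    gagliardoSeminorm s p (u : 𝔼 → ℝ) ^ p = ENNReal.ofReal (‖sobolevQuotient s p Ω u‖ ^ p) := by
  rw [gagliardoSeminorm_eq_eLpNorm s hp, ← eLpNorm_congr_ae (coeFn_sobolevQuotient u),
    Lp.norm_def, ← ENNReal.ofReal_rpow_of_nonneg ENNReal.toReal_nonneg hp.le,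
    ENNReal.ofReal_toReal (Lp.eLpNorm_ne_top _)]

theorem fracPLaplacePairing_eq_dualityPairing_sobolevQuotient (hp : 0 < p)
    (u w : sobolevZero s p Ω) :
    fracPLaplacePairing s p (u : 𝔼 → ℝ) w = dualityPairing p (volume.prod volume)
      (sobolevQuotient s p Ω u) (sobolevQuotient s p Ω w) := by
  rw [fracPLaplacePairing_eq_dualityPairing s hp]
  exact (dualityPairing_congr_ae (coeFn_sobolevQuotient u) (coeFn_sobolevQuotient w)).symm

variable [NeZero N]

theorem integrableOn_of_mem_sobolevZero (hs : 0 ≤ s) (hΩ : volume Ω ≠ ⊤) {u : 𝔼 → ℝ}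
    (hu : u ∈ sobolevZero s p Ω) : IntegrableOn u Ω := by
  have hp : 1 ≤ p := ENNReal.one_le_ofReal.1 Fact.out
  exact integrableOn_of_mem_gagliardoSpace (diffOrder_nonneg N hs (by linarith)) hp hΩ
    (sobolevZero_le_gagliardoSpace s p Ω hu)

/-- Integration over `Ω` as a linear functional on `W_0^{s,p}(Ω)`, the right-hand side of the
torsion equation. -/
noncomputable def sobolevIntegral (hs : 0 ≤ s) (hΩ : volume Ω ≠ ⊤) : sobolevZero s p Ω →ₗ[ℝ] ℝ where
  toFun u := ∫ x in Ω, (u : 𝔼 → ℝ) x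
  map_add' u v := integral_add (integrableOn_of_mem_sobolevZero hs hΩ u.2)
    (integrableOn_of_mem_sobolevZero hs hΩ v.2)
  map_smul' c _ := integral_const_mul c _

theorem exists_abs_sobolevIntegral_le (hs : 0 ≤ s) (hΩ : volume Ω ≠ ⊤) :
    ∃ C, ∀ u : sobolevZero s p Ω, |sobolevIntegral hs hΩ u| ≤ C * ‖sobolevQuotient s p Ω u‖ := by
  have hp : 1 ≤ p := ENNReal.one_le_ofReal.1 Fact.out
  obtain ⟨C, hC⟩ := exists_abs_setIntegral_le_mul_norm_diffQuotientLp (μ := volume)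
    (diffOrder_nonneg N hs (by linarith)) hp hΩ
  exact ⟨C, fun u => hC (Submodule.inclusion (sobolevZero_le_gagliardoSpace s p Ω) u)⟩

theorem sobolevIntegral_ne_zero (hs0 : 0 < s) (hs1 : s < 1) (hp : 0 < p) (hΩ : volume Ω ≠ ⊤)
    (hopen : IsOpen Ω) (hne : Ω.Nonempty) :
    (sobolevIntegral hs0.le hΩ : sobolevZero s p Ω →ₗ[ℝ] ℝ) ≠ 0 := fun hzero => by
  obtain ⟨η, hη, hpos⟩ := exists_isTestFunction_integral_pos hopen hne
  have hmem : η ∈ sobolevZero s p Ω :=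
    mem_sobolevZero_iff_exists_tendsto.2 ⟨hη.mem_gagliardoSpace hs0 hs1 hp, fun _ => ⟨η, _⟩,
      fun _ => hη, tendsto_const_nhds⟩
  exact hpos.ne' (LinearMap.congr_fun hzero ⟨η, hmem⟩)

theorem isClosed_range_sobolevQuotient (hs : 0 ≤ s) (hp : 0 < p) (hΩ : volume Ω ≠ ⊤) :
    IsClosed (range (sobolevQuotient s p Ω)) := by
  have hrange : range (sobolevQuotient s p Ω) =
      range (diffQuotientLp (diffOrder N s p) p volume Ω) ∩
      (((testFunctions Ω).comap (gagliardoSpace (diffOrder N s p) p volume Ω).subtype).map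
        (diffQuotientLp ..)).topologicalClosure := by
    ext g
    constructor
    · rintro ⟨⟨_, w, hw, rfl⟩, rfl⟩
      exact ⟨⟨w, rfl⟩, hw⟩
    · rintro ⟨⟨w, rfl⟩, hw⟩
      exact ⟨⟨w, w, hw, rfl⟩, rfl⟩
  rw [hrange]
  exact (isClosed_range_diffQuotientLp (diffOrder_nonneg N hs hp) hp hΩ).inter
    (Submodule.isClosed_topologicalClosure _)

theorem ae_eq_of_sobolevQuotient_eq (hs : 0 ≤ s) (hp : 0 < p) (hΩ : volume Ω ≠ ⊤)
    {u v : sobolevZero s p Ω} (h : sobolevQuotient s p Ω u = sobolevQuotient s p Ω v) :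
    (u : 𝔼 → ℝ) =ᵐ[volume] v :=
  ae_eq_of_diffQuotientLp_eq (diffOrder_nonneg N hs hp) hp hΩ h

end SobolevQuotient

/-! ### The torsion function -/

section Torsion

variable {N : ℕ} [NeZero N] {s p : ℝ} [Fact (1 ≤ ENNReal.ofReal p)]
  {Ω : Set (EuclideanSpace ℝ (Fin N))} {φ ψ v : EuclideanSpace ℝ (Fin N) → ℝ}

local notation "𝔼" => EuclideanSpace ℝ (Fin N)

theorem isTorsionFunction_iff (hs0 : 0 < s) (hs1 : s < 1) (hp : 0 < p) (hΩ : volume Ω ≠ ⊤) :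
    IsTorsionFunction s p Ω φ ↔ ∃ u : sobolevZero s p Ω, (u : 𝔼 → ℝ) = φ ∧
      ∀ w, dualityPairing p (volume.prod volume) (sobolevQuotient s p Ω u)
        (sobolevQuotient s p Ω w) = sobolevIntegral hs0.le hΩ w := by
  simp only [IsTorsionFunction, IsWeakSolution, memW0_iff_mem_sobolevZero hs0 hs1 hp hΩ, one_mul,
    ← fracPLaplacePairing_eq_dualityPairing_sobolevQuotient hp, Subtype.forall, Subtype.exists,
    exists_and_left, exists_prop]
  constructor
  · exact fun ⟨hφ, h⟩ => ⟨φ, rfl, hφ, h⟩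
  · rintro ⟨_, rfl, hφ, h⟩
    exact ⟨hφ, h⟩

theorem exists_isTorsionFunction (hs0 : 0 < s) (hs1 : s < 1) (hp : 1 < p) (hΩ : volume Ω ≠ ⊤) :
    ∃ φ, IsTorsionFunction s p Ω φ := by
  have hp0 : 0 < p := by linarith
  obtain ⟨C, hC⟩ := exists_abs_sobolevIntegral_le (s := s) (p := p) hs0.le hΩ
  obtain ⟨u, hu⟩ := exists_dualityPairing_eq hp (isClosed_range_sobolevQuotient hs0.le hp0 hΩ) hC
  exact ⟨u, (isTorsionFunction_iff hs0 hs1 hp0 hΩ).2 ⟨u, rfl, hu⟩⟩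

theorem IsTorsionFunction.ae_eq (hs0 : 0 < s) (hs1 : s < 1) (hp : 1 < p) (hΩ : volume Ω ≠ ⊤)
    (hφ : IsTorsionFunction s p Ω φ) (hψ : IsTorsionFunction s p Ω ψ) : ψ =ᵐ[volume] φ := by
  have hp0 : 0 < p := by linarith
  obtain ⟨u, rfl, hu⟩ := (isTorsionFunction_iff hs0 hs1 hp0 hΩ).1 hφ
  obtain ⟨w, rfl, hw⟩ := (isTorsionFunction_iff hs0 hs1 hp0 hΩ).1 hψ
  exact ae_eq_of_sobolevQuotient_eq hs0.le hp0 hΩ (eq_of_dualityPairing_eq hp hu hw)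

/-- Passing from `φ` to `|φ|` does not decrease the integral and does not increase the Gagliardo
seminorm. -/
theorem IsTorsionFunction.ae_nonneg (hs0 : 0 < s) (hs1 : s < 1) (hp : 1 < p) (hΩ : volume Ω ≠ ⊤)
    (hφ : IsTorsionFunction s p Ω φ) : ∀ᵐ x ∂volume, 0 ≤ φ x := by
  have hp0 : 0 < p := by linarith
  obtain ⟨u, rfl, hu⟩ := (isTorsionFunction_iff hs0 hs1 hp0 hΩ).1 hφ
  let w : sobolevZero s p Ω := ⟨|u|, abs_mem_sobolevZero hs0 hs1 hp0 hΩ u.2⟩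
  have hle : sobolevIntegral hs0.le hΩ u ≤ sobolevIntegral hs0.le hΩ w :=
    integral_mono (integrableOn_of_mem_sobolevZero hs0.le hΩ u.2)
      (integrableOn_of_mem_sobolevZero hs0.le hΩ w.2) fun x => le_abs_self _
  have hquotient := eq_of_apply_le_of_norm_le hp hu hle
    (norm_diffQuotientLp_le_of_abs_sub_le fun _ _ => abs_abs_sub_abs_le _ _)
  filter_upwards [ae_eq_of_sobolevQuotient_eq hs0.le hp0 hΩ hquotient] with x hx
  exact hx ▸ abs_nonneg _

theorem normL_one_eq_sobolevIntegral (hs : 0 ≤ s) (hΩ : volume Ω ≠ ⊤) {u : sobolevZero s p Ω}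
    (hu : ∀ᵐ x ∂volume, 0 ≤ (u : 𝔼 → ℝ) x) :
    normL 1 Ω (u : 𝔼 → ℝ) = ENNReal.ofReal (sobolevIntegral hs hΩ u) := by
  rw [normL, ENNReal.ofReal_one, eLpNorm_one_eq_lintegral_enorm,
    ← ofReal_integral_norm_eq_lintegral_enorm (integrableOn_of_mem_sobolevZero hs hΩ u.2)]
  refine congrArg _ (integral_congr_ae (ae_restrict_of_ae ?_))
  filter_upwards [hu] with x hx
  exact Real.norm_of_nonneg hx

theorem IsTorsionFunction.exists_sobolevZero (hs0 : 0 < s) (hs1 : s < 1) (hp : 1 < p)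
    (hΩ : volume Ω ≠ ⊤) (hopen : IsOpen Ω) (hne : Ω.Nonempty) (hφ : IsTorsionFunction s p Ω φ) :
    ∃ u : sobolevZero s p Ω, (u : 𝔼 → ℝ) = φ ∧
      (∀ w, dualityPairing p (volume.prod volume) (sobolevQuotient s p Ω u)
        (sobolevQuotient s p Ω w) = sobolevIntegral hs0.le hΩ w) ∧
      0 < sobolevIntegral hs0.le hΩ u ∧
      normL 1 Ω φ = ENNReal.ofReal (sobolevIntegral hs0.le hΩ u) ∧
      normalizeL1 Ω φ = ((sobolevIntegral hs0.le hΩ u)⁻¹ • u : sobolevZero s p Ω) := by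
  have hp0 : 0 < p := by linarith
  have hnonneg := hφ.ae_nonneg hs0 hs1 hp hΩ
  obtain ⟨u, rfl, hu⟩ := (isTorsionFunction_iff hs0 hs1 hp0 hΩ).1 hφ
  have hpos := apply_pos_of_dualityPairing_eq hp0 hu
    (sobolevIntegral_ne_zero hs0 hs1 hp0 hΩ hopen hne)
  have hnorm := normL_one_eq_sobolevIntegral hs0.le hΩ hnonneg
  refine ⟨u, rfl, hu, hpos, hnorm, funext fun x => ?_⟩
  rw [normalizeL1, hnorm, ENNReal.toReal_ofReal hpos.le]
  exact div_eq_inv_mul _ _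

theorem one_div_ofReal_rpow {a : ℝ} (ha : 0 < a) (r : ℝ) :
    1 / ENNReal.ofReal a ^ r = ENNReal.ofReal (1 / a ^ r) := by
  rw [ENNReal.ofReal_rpow_of_pos ha, one_div, one_div, ENNReal.ofReal_inv_of_pos (by positivity)]

variable (hs0 : 0 < s) (hs1 : s < 1) (hp : 1 < p) (hΩ : volume Ω ≠ ⊤) (hopen : IsOpen Ω)
  (hne : Ω.Nonempty) (hφ : IsTorsionFunction s p Ω φ)
include hs0 hs1 hp hΩ hopen hne hφ

theorem IsTorsionFunction.normL_one_pos : 0 < normL 1 Ω φ := by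
  obtain ⟨u, -, -, hpos, hnorm, -⟩ := hφ.exists_sobolevZero hs0 hs1 hp hΩ hopen hne
  exact hnorm ▸ ENNReal.ofReal_pos.2 hpos

theorem IsTorsionFunction.normL_one_lt_top : normL 1 Ω φ < ⊤ := by
  obtain ⟨u, -, -, -, hnorm, -⟩ := hφ.exists_sobolevZero hs0 hs1 hp hΩ hopen hne
  exact hnorm ▸ ENNReal.ofReal_lt_top

theorem IsTorsionFunction.one_div_normL_one_rpow_le (hv : MemW0 s p Ω v) (hv1 : normL 1 Ω v = 1) :
    1 / normL 1 Ω φ ^ (p - 1) ≤ gagliardoSeminorm s p v ^ p := by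
  have hp0 : 0 < p := by linarith
  obtain ⟨u, -, hu, hpos, hnorm, -⟩ := hφ.exists_sobolevZero hs0 hs1 hp hΩ hopen hne
  lift v to sobolevZero s p Ω using (memW0_iff_mem_sobolevZero hs0 hs1 hp0 hΩ).1 hv
  let w : sobolevZero s p Ω := ⟨|v|, abs_mem_sobolevZero hs0 hs1 hp0 hΩ v.2⟩
  have hw1 : normL 1 Ω (w : 𝔼 → ℝ) = 1 :=
    (eLpNorm_congr_norm_ae (.of_forall fun x => abs_abs _)).trans hv1
  rw [normL_one_eq_sobolevIntegral hs0.le hΩ (.of_forall fun x => abs_nonneg _),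
    ENNReal.ofReal_eq_one] at hw1
  rw [hnorm, one_div_ofReal_rpow hpos, gagliardoSeminorm_rpow_eq hp0]
  refine ENNReal.ofReal_le_ofReal ((one_div_le_norm_rpow hp hu hpos hw1).trans ?_)
  exact Real.rpow_le_rpow (norm_nonneg _)
    (norm_diffQuotientLp_le_of_abs_sub_le fun _ _ => abs_abs_sub_abs_le _ _) hp0.le

theorem IsTorsionFunction.memW0_normalizeL1 : MemW0 s p Ω (normalizeL1 Ω φ) := by
  obtain ⟨u, -, -, -, -, hnormalize⟩ := hφ.exists_sobolevZero hs0 hs1 hp hΩ hopen hne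
  exact (memW0_iff_mem_sobolevZero hs0 hs1 (by linarith) hΩ).2 (hnormalize ▸ Subtype.prop _)

theorem IsTorsionFunction.normL_one_normalizeL1 : normL 1 Ω (normalizeL1 Ω φ) = 1 := by
  have hnonneg := hφ.ae_nonneg hs0 hs1 hp hΩ
  obtain ⟨u, rfl, -, hpos, -, hnormalize⟩ := hφ.exists_sobolevZero hs0 hs1 hp hΩ hopen hne
  rw [hnormalize, normL_one_eq_sobolevIntegral hs0.le hΩ, map_smul, smul_eq_mul,
    inv_mul_cancel₀ hpos.ne', ENNReal.ofReal_one]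
  filter_upwards [hnonneg] with x hx
  exact mul_nonneg (inv_nonneg.2 hpos.le) hx

theorem IsTorsionFunction.gagliardoSeminorm_normalizeL1_rpow :
    gagliardoSeminorm s p (normalizeL1 Ω φ) ^ p = 1 / normL 1 Ω φ ^ (p - 1) := by
  have hp0 : 0 < p := by linarith
  obtain ⟨u, -, hu, hpos, hnorm, hnormalize⟩ := hφ.exists_sobolevZero hs0 hs1 hp hΩ hopen hne
  rw [hnormalize, gagliardoSeminorm_rpow_eq hp0, norm_inv_smul_rpow_eq_one_div hp0 hu hpos, hnorm,
    one_div_ofReal_rpow hpos]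

theorem IsTorsionFunction.ae_eq_normalizeL1 (hv : MemW0 s p Ω v) (hv1 : normL 1 Ω v = 1)
    (hv0 : ∀ᵐ x ∂volume, 0 ≤ v x)
    (hmin : gagliardoSeminorm s p v ^ p = 1 / normL 1 Ω φ ^ (p - 1)) :
    v =ᵐ[volume] normalizeL1 Ω φ := by
  have hp0 : 0 < p := by linarith
  obtain ⟨u, -, hu, hpos, hnorm, hnormalize⟩ := hφ.exists_sobolevZero hs0 hs1 hp hΩ hopen hne
  lift v to sobolevZero s p Ω using (memW0_iff_mem_sobolevZero hs0 hs1 hp0 hΩ).1 hv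
  rw [normL_one_eq_sobolevIntegral hs0.le hΩ hv0, ENNReal.ofReal_eq_one] at hv1
  rw [hnorm, one_div_ofReal_rpow hpos, gagliardoSeminorm_rpow_eq hp0,
    ENNReal.ofReal_eq_ofReal_iff (by positivity) (by positivity)] at hmin
  rw [hnormalize]
  refine ae_eq_of_sobolevQuotient_eq hs0.le hp0 hΩ ?_
  rw [map_smul, eq_inv_smul_iff₀ hpos.ne', ← map_smul]
  exact smul_eq_of_norm_rpow_eq_one_div hp hu hpos hv1 hmin

end Torsion

theorem mainTheorem2_general {N : ℕ} [NeZero N] {Ω : Set (EuclideanSpace ℝ (Fin N))}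
    (hopen : IsOpen Ω) (hne : Ω.Nonempty) (hΩ : volume Ω ≠ ⊤) {s p : ℝ} (hs0 : 0 < s)
    (hs1 : s < 1) (hp : 1 < p) :
    (∃ φ : EuclideanSpace ℝ (Fin N) → ℝ, IsTorsionFunction s p Ω φ ∧
      ∀ ψ : EuclideanSpace ℝ (Fin N) → ℝ, IsTorsionFunction s p Ω ψ → ψ =ᵐ[volume] φ) ∧
    ∀ φ : EuclideanSpace ℝ (Fin N) → ℝ, IsTorsionFunction s p Ω φ →
      (∀ᵐ x ∂volume, 0 ≤ φ x) ∧ 0 < normL 1 Ω φ ∧ normL 1 Ω φ < ⊤ ∧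
      IsLeast {t : ℝ≥0∞ | ∃ v : EuclideanSpace ℝ (Fin N) → ℝ,
          MemW0 s p Ω v ∧ normL 1 Ω v = 1 ∧ t = gagliardoSeminorm s p v ^ p}
        (1 / normL 1 Ω φ ^ (p - 1)) ∧
      (MemW0 s p Ω (normalizeL1 Ω φ) ∧ normL 1 Ω (normalizeL1 Ω φ) = 1 ∧
        gagliardoSeminorm s p (normalizeL1 Ω φ) ^ p = 1 / normL 1 Ω φ ^ (p - 1)) ∧
      ∀ v : EuclideanSpace ℝ (Fin N) → ℝ, MemW0 s p Ω v → normL 1 Ω v = 1 →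
        (∀ᵐ x ∂volume, 0 ≤ v x) →
        gagliardoSeminorm s p v ^ p = 1 / normL 1 Ω φ ^ (p - 1) →
        v =ᵐ[volume] normalizeL1 Ω φ := by
  have : Fact (1 ≤ ENNReal.ofReal p) := ⟨ENNReal.one_le_ofReal.2 hp.le⟩
  obtain ⟨φ₀, hφ₀⟩ := exists_isTorsionFunction (Ω := Ω) hs0 hs1 hp hΩ
  refine ⟨⟨φ₀, hφ₀, fun ψ hψ => hφ₀.ae_eq hs0 hs1 hp hΩ hψ⟩, fun φ hφ => ?_⟩
  have hmem := hφ.memW0_normalizeL1 hs0 hs1 hp hΩ hopen hne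
  have hone := hφ.normL_one_normalizeL1 hs0 hs1 hp hΩ hopen hne
  have hvalue := hφ.gagliardoSeminorm_normalizeL1_rpow hs0 hs1 hp hΩ hopen hne
  refine ⟨hφ.ae_nonneg hs0 hs1 hp hΩ, hφ.normL_one_pos hs0 hs1 hp hΩ hopen hne,
    hφ.normL_one_lt_top hs0 hs1 hp hΩ hopen hne, ⟨⟨_, hmem, hone, hvalue.symm⟩, ?_⟩,
    ⟨hmem, hone, hvalue⟩, fun v => hφ.ae_eq_normalizeL1 hs0 hs1 hp hΩ hopen hne⟩
  rintro _ ⟨v, hv, hv1, rfl⟩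
  exact hφ.one_div_normL_one_rpow_le hs0 hs1 hp hΩ hopen hne hv hv1

theorem mainTheorem2 (N : ℕ) (hN : 2 ≤ N) (Ω : Set (EuclideanSpace ℝ (Fin N)))
    (hΩ : IsBoundedLipschitzDomain Ω) (s p : ℝ) (hs0 : 0 < s) (hs1 : s < 1) (hp : 1 < p)
    (hpN : p < (N : ℝ) / s) :
    -- the torsion function exists and is unique
    (∃ φ : EuclideanSpace ℝ (Fin N) → ℝ, IsTorsionFunction s p Ω φ ∧
      ∀ ψ : EuclideanSpace ℝ (Fin N) → ℝ, IsTorsionFunction s p Ω ψ → ψ =ᵐ[volume] φ) ∧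
    ∀ φ : EuclideanSpace ℝ (Fin N) → ℝ, IsTorsionFunction s p Ω φ →
      -- it is nonnegative, with `0 < |φ|_1 < ∞`
      (∀ᵐ x ∂volume, 0 ≤ φ x) ∧ 0 < normL 1 Ω φ ∧ normL 1 Ω φ < ⊤ ∧
      -- the minimum is `1 / |φ|_1 ^ (p - 1)`
      IsLeast {t : ℝ≥0∞ | ∃ v : EuclideanSpace ℝ (Fin N) → ℝ,
          MemW0 s p Ω v ∧ normL 1 Ω v = 1 ∧ t = gagliardoSeminorm s p v ^ p}
        (1 / normL 1 Ω φ ^ (p - 1)) ∧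
      -- it is attained at `φ / |φ|_1`
      (MemW0 s p Ω (normalizeL1 Ω φ) ∧ normL 1 Ω (normalizeL1 Ω φ) = 1 ∧
        gagliardoSeminorm s p (normalizeL1 Ω φ) ^ p = 1 / normL 1 Ω φ ^ (p - 1)) ∧
      -- and at no other nonnegative function
      ∀ v : EuclideanSpace ℝ (Fin N) → ℝ, MemW0 s p Ω v → normL 1 Ω v = 1 →
        (∀ᵐ x ∂volume, 0 ≤ v x) →
        gagliardoSeminorm s p v ^ p = 1 / normL 1 Ω φ ^ (p - 1) →
        v =ᵐ[volume] normalizeL1 Ω φ := by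
  have : NeZero N := ⟨by omega⟩
  exact mainTheorem2_general hΩ.isOpen hΩ.isConnected.nonempty hΩ.isBounded.measure_lt_top.ne
    hs0 hs1 hp
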